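/- **Conventions.** A finite chain $(V,\mu,\nu)$ is a finite ergodic Markov chain $\mu(u\to v)$ on $V$, reversible with respect to a probability measure $\nu$ on $V$; its spectral gap is the difference between $1$ and the second largest eigenvalue of the averaging operator $Af(u)=\sum_v \mu(u\to v)f(v)$ (a one-point chain has gap $+\infty$). For a metric space $Y$ and $\sigma\in\mathbb R$, the Poincaré modulus $\Lambda^{(2)}_Y(\sigma)\in[0,\infty]$ is the smallest $\Lambda$ such that for every finite chain with spectral gap at least $\sigma$ and every $f\colon V\to Y$, $$\sum_{u,v}\nu(u)\nu(v)\,d_Y(f(u),f(v))^2\le \Lambda^2\sum_{u,v}\nu(u)\mu(u\to v)\,d_Y(f(u),f(v))^2 .$$ The local Poincaré modulus is $\Lambda^{(2)}_Y(\sigma,N)=\sup\{\Lambda^{(2)}_{Y'}(\sigma): Y'\subseteq Y,\ |Y'|\le N\}$. The tangent cone $T_yY$ of $Y$ at $y$ is the infinite cone over the space of directions at $y$, that is, over the unit-speed geodesic segments issuing from $y$ with the Alexandroff angle $\theta$ as distance (segments at angle zero being identified); the cone metric is $\tilde d(a\gamma,b\gamma')=\sqrt{a^2+b^2-2ab\cos\theta(\gamma,\gamma')}$.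 **Proposition.** Let $Y$ be a complete $\mathrm{CAT}(0)$ space. Then for all $\sigma\in\mathbb R$ and $N\in\mathbb N$, $$\Lambda^{(2)}_Y(\sigma,N)\le 2\sup_{y\in Y}\Lambda^{(2)}_{T_yY}(\sigma,N),\qquad \Lambda^{(2)}_Y(\sigma)\le 2\sup_{y\in Y}\Lambda^{(2)}_{T_yY}(\sigma).$$ **Corollary.** Let $M$ be a smooth manifold modelled on a real Hilbert space (of finite or infinite dimension) with a smooth Riemannian metric that induces on each tangent space its given topology. Suppose that $M$ with its Riemannian distance is a complete $\mathrm{CAT}(0)$ space. Then $\Lambda^{(2)}_M(\sigma)\le 2/\sqrt\sigma$ for every $\sigma>0$. If moreover $M$ has at least two points and $\sigma\le 2$, then $\Lambda^{(2)}_M(\sigma)\ge 1/\sqrt\sigma$. -/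

import Mathlib

open scoped ENNReal Topology ContDiff Manifold Bundle

noncomputable section

namespace WangTrick

universe u

/-! ### Finite reversible Markov chains and their spectral gap -/

/-- A finite ergodic Markov chain with state space `V` and transition probabilities
`P u v = μ(u → v)`, reversible with respect to the probability measure `ν`. -/
structure ReversibleChain (V : Type) [Fintype V] [DecidableEq V] where
  P : Matrix V V ℝ
  P_nonneg : ∀ u v, 0 ≤ P u v
  P_sum : ∀ u, ∑ v, P u v = 1
  ν : V → ℝ
  ν_nonneg : ∀ u, 0 ≤ ν u
  ν_sum : ∑ u, ν u = 1
  reversible : ∀ u v, ν u * P u v = ν v * P v u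
  ergodic : ∀ u v, ∃ n ≥ 1, 0 < (P ^ n) u v

/-- The spectral gap: the difference between `1` and the second largest eigenvalue of the averaging
operator `(A f) u = ∑ v, P u v * f v`. For an ergodic chain the eigenvalue `1` is simple, and the
second largest eigenvalue is the largest one different from `1`. A one-point chain has no other
eigenvalue and gets the gap `⊤`. -/
def ReversibleChain.spectralGap {V : Type} [Fintype V] [DecidableEq V]
    (C : ReversibleChain V) : EReal :=
  ⨅ (r : ℝ) (_ : Module.End.HasEigenvalue (Matrix.toLin' C.P) r ∧ r ≠ 1), ((1 - r : ℝ) : EReal)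

/-! ### Poincaré moduli -/

/-- The Poincaré modulus of exponent `p` of the metric space `Y`: the smallest `Λ ∈ [0, ∞]` such
that the Poincaré inequality with constant `Λ ^ p` holds for all functions into `Y` on all finite
reversible ergodic Markov chains with spectral gap at least `σ`. -/
def poincareModulus (p : ℝ) (Y : Type u) [MetricSpace Y] (σ : ℝ) : ℝ≥0∞ :=
  sInf {L : ℝ≥0∞ | ∀ (V : Type) [Fintype V] [DecidableEq V] (C : ReversibleChain V),
    (σ : EReal) ≤ C.spectralGap → ∀ f : V → Y,
      ENNReal.ofReal (∑ u, ∑ v, C.ν u * C.ν v * dist (f u) (f v) ^ p) ≤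
        L ^ p * ENNReal.ofReal (∑ u, ∑ v, C.ν u * C.P u v * dist (f u) (f v) ^ p)}

/-- The local Poincaré modulus: the supremum of the Poincaré moduli of the subsets with at most
`N` points. -/
def localPoincareModulus (p : ℝ) (Y : Type u) [MetricSpace Y] (σ : ℝ) (N : ℕ) : ℝ≥0∞ :=
  ⨆ (Y' : Set Y) (_ : Y'.encard ≤ N), poincareModulus p Y' σ

/-! ### Geodesics and CAT(0) spaces -/

/-- `γ` restricted to `[0, L]` is a unit-speed geodesic segment. -/
def IsGeodesicOn {Y : Type u} [MetricSpace Y] (γ : ℝ → Y) (L : ℝ) : Prop :=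
  ∀ s ∈ Set.Icc 0 L, ∀ t ∈ Set.Icc 0 L, dist (γ s) (γ t) = |s - t|

/-- `γ` restricted to `[0, dist y z]` is a unit-speed geodesic segment connecting `y` to `z`. -/
structure IsGeodesicFromTo {Y : Type u} [MetricSpace Y] (γ : ℝ → Y) (y z : Y) : Prop where
  left : γ 0 = y
  right : γ (dist y z) = z
  isGeodesicOn : IsGeodesicOn γ (dist y z)

/-- CAT(0) spaces: geodesic spaces whose triangles are not thicker than their reference triangles
in the Euclidean plane. Any two sides of a triangle have a common vertex, from which both can be
parametrised, so the points to be compared are taken on two geodesic segments issuing from `x`;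
the point at fraction `a` of the way from `x` to `y` is compared with the point at
fraction `a` of the way from `X` to `Y'`. -/
structure IsCAT0 (Y : Type u) [MetricSpace Y] : Prop where
  geodesic : ∀ y z : Y, ∃ γ : ℝ → Y, IsGeodesicFromTo γ y z
  comparison : ∀ (x y z : Y) (γ γ' : ℝ → Y), IsGeodesicFromTo γ x y → IsGeodesicFromTo γ' x z →
    ∀ X Y' Z : EuclideanSpace ℝ (Fin 2),
      dist X Y' = dist x y → dist X Z = dist x z → dist Y' Z = dist y z →
      ∀ a ∈ Set.Icc (0 : ℝ) 1, ∀ b ∈ Set.Icc (0 : ℝ) 1,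
        dist (γ (a * dist x y)) (γ' (b * dist x z)) ≤
          dist (AffineMap.lineMap X Y' a) (AffineMap.lineMap X Z b)

/-! ### Planar trigonometry -/

/-- The third side of a planar triangle with two sides `a`, `b` enclosing the angle `θ`. -/
def sideLength (a b θ : ℝ) : ℝ := √(a ^ 2 + b ^ 2 - 2 * a * b * Real.cos θ)

theorem sideLength_nonneg (a b θ : ℝ) : 0 ≤ sideLength a b θ := Real.sqrt_nonneg _

theorem radicand_nonneg (a b θ : ℝ) : 0 ≤ a ^ 2 + b ^ 2 - 2 * a * b * Real.cos θ := by
  nlinarith [sq_nonneg (a - b * Real.cos θ), Real.sin_sq_add_cos_sq θ,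
    mul_nonneg (sq_nonneg b) (sq_nonneg (Real.sin θ))]

theorem norm_polar_sub (a b s t : ℝ) :
    ‖(⟨a * Real.cos s, a * Real.sin s⟩ : ℂ) - ⟨b * Real.cos t, b * Real.sin t⟩‖ =
      sideLength a b (s - t) := by
  rw [sideLength, Complex.norm_def, Complex.normSq_apply]
  congr 1
  simp only [Complex.sub_re, Complex.sub_im, Real.cos_sub]
  linear_combination a ^ 2 * Real.sin_sq_add_cos_sq s + b ^ 2 * Real.sin_sq_add_cos_sq t

theorem sideLength_comm (a b θ : ℝ) : sideLength a b θ = sideLength b a θ := by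
  unfold sideLength; congr 1; ring

theorem sideLength_mono {a b s t : ℝ} (ha : 0 ≤ a) (hb : 0 ≤ b) (hs : 0 ≤ s) (ht : t ≤ Real.pi)
    (h : s ≤ t) : sideLength a b s ≤ sideLength a b t := by
  unfold sideLength
  apply Real.sqrt_le_sqrt
  have := Real.cos_le_cos_of_nonneg_of_le_pi hs ht h
  nlinarith [mul_nonneg ha hb]

theorem sideLength_triangle {a b c r s t : ℝ} (ha : 0 ≤ a) (hb : 0 ≤ b) (hc : 0 ≤ c)
    (hrp : r ≤ Real.pi) (hs : 0 ≤ s) (hsp : s ≤ Real.pi)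
    (ht : 0 ≤ t) (htp : t ≤ Real.pi) (h : t ≤ r + s) :
    sideLength a c t ≤ sideLength a b r + sideLength b c s := by
  have key : sideLength a c (r + min s (Real.pi - r)) ≤
      sideLength a b r + sideLength b c (min s (Real.pi - r)) := by
    have h1 := norm_polar_sub a c r (-min s (Real.pi - r))
    have h2 := norm_polar_sub a b r 0
    have h3 := norm_polar_sub b c 0 (-min s (Real.pi - r))
    rw [sub_neg_eq_add] at h1 h3
    rw [sub_zero] at h2
    rw [zero_add] at h3
    rw [← h1, ← h2, ← h3]
    exact norm_sub_le_norm_sub_add_norm_sub _ _ _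
  have hm : 0 ≤ min s (Real.pi - r) := le_min hs (by linarith)
  have hm' : r + min s (Real.pi - r) ≤ Real.pi := by
    linarith [min_le_right s (Real.pi - r)]
  have hm2 : t ≤ r + min s (Real.pi - r) := by
    rcases min_choice s (Real.pi - r) with e | e <;> rw [e] <;> linarith
  calc sideLength a c t ≤ sideLength a c (r + min s (Real.pi - r)) :=
        sideLength_mono ha hc ht hm' hm2
    _ ≤ _ := key
    _ ≤ _ := by
        gcongr
        exact sideLength_mono hb hc hm hsp (min_le_left _ _)

/-- A segment that is seen under the angle `r + s` is cut by the ray at angle `r`. -/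
theorem exists_sideLength_add {a c r s : ℝ} (ha : 0 < a) (hc : 0 < c) (hr : 0 < r) (hs : 0 < s)
    (h : r + s < Real.pi) :
    ∃ b, 0 < b ∧ b ≤ max a c ∧
      sideLength a c (r + s) = sideLength a b r + sideLength b c s := by
  have hsr : 0 < Real.sin r := Real.sin_pos_of_pos_of_lt_pi hr (by linarith)
  have hss : 0 < Real.sin s := Real.sin_pos_of_pos_of_lt_pi hs (by linarith)
  have hsrs : 0 < Real.sin (r + s) := Real.sin_pos_of_pos_of_lt_pi (by linarith) h
  set D : ℝ := a * Real.sin r + c * Real.sin s with hD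
  have hDpos : 0 < D := by positivity
  set b : ℝ := a * c * Real.sin (r + s) / D with hb
  have hbpos : 0 < b := by positivity
  set z1 : ℂ := ⟨a * Real.cos r, a * Real.sin r⟩ with hz1
  set z2 : ℂ := ⟨b * Real.cos 0, b * Real.sin 0⟩ with hz2
  set z3 : ℂ := ⟨c * Real.cos (-s), c * Real.sin (-s)⟩ with hz3
  have hmem : z2 ∈ segment ℝ z1 z3 := by
    refine ⟨c * Real.sin s / D, a * Real.sin r / D, by positivity, by positivity, ?_, ?_⟩
    · rw [← add_div, hD]; field_simp; ring
    · apply Complex.ext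
      · simp only [hz1, hz2, hz3, Complex.add_re, Complex.real_smul, Complex.mul_re,
          Complex.ofReal_re, Complex.ofReal_im, Real.cos_neg, Real.cos_zero, hb, Real.sin_add]
        field_simp
        ring
      · simp only [hz1, hz2, hz3, Complex.add_im, Complex.real_smul, Complex.mul_im,
          Complex.ofReal_re, Complex.ofReal_im, Real.sin_neg, Real.sin_zero]
        field_simp
        ring
  have hn : ∀ x t : ℝ, 0 < x → ‖(⟨x * Real.cos t, x * Real.sin t⟩ : ℂ)‖ = x := by
    intro x t hx
    have h1 := norm_polar_sub x 0 t t
    have h0 : (⟨0 * Real.cos t, 0 * Real.sin t⟩ : ℂ) = 0 := by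
      apply Complex.ext <;> simp
    rw [h0, sub_zero] at h1
    rw [h1, sideLength]
    simp [Real.sqrt_sq hx.le]
  refine ⟨b, hbpos, ?_, ?_⟩
  · have hball : segment ℝ z1 z3 ⊆ Metric.closedBall (0 : ℂ) (max a c) := by
      apply (convex_closedBall (0 : ℂ) (max a c)).segment_subset
      · rw [mem_closedBall_zero_iff, hn _ _ ha]; exact le_max_left _ _
      · rw [mem_closedBall_zero_iff, hn _ _ hc]; exact le_max_right _ _
    have := hball hmem
    rwa [mem_closedBall_zero_iff, hn _ _ hbpos] at this
  · have hd := dist_add_dist_of_mem_segment hmem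
    rw [dist_eq_norm, dist_eq_norm, dist_eq_norm] at hd
    rw [hz1, hz2, hz3, norm_polar_sub, norm_polar_sub, norm_polar_sub] at hd
    simpa using hd.symm

/-! ### Alexandroff angles and the space of directions -/

/-- The angle at the vertex corresponding to `y` in a Euclidean reference triangle for
`y, p, q`. -/
def comparisonAngle {Y : Type u} [MetricSpace Y] (y p q : Y) : ℝ :=
  Real.arccos ((dist y p ^ 2 + dist y q ^ 2 - dist p q ^ 2) / (2 * dist y p * dist y q))

/-- A unit-speed geodesic segment `[0, length] → Y` of positive length issuing from `y`
(the values of `toFun` outside `[0, length]` play no role). -/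
structure GeodesicFrom {Y : Type u} [MetricSpace Y] (y : Y) where
  toFun : ℝ → Y
  length : ℝ
  length_pos : 0 < length
  start : toFun 0 = y
  isGeodesicOn : IsGeodesicOn toFun length

/-- The Alexandroff angle of two geodesic segments issuing from `y`: the upper limit of the
reference angles as `t, t' → 0` from the right. -/
def alexandroffAngle {Y : Type u} [MetricSpace Y] {y : Y} (γ γ' : GeodesicFrom y) : ℝ :=
  Filter.limsup (fun q : ℝ × ℝ => comparisonAngle y (γ.toFun q.1) (γ'.toFun q.2))
    (𝓝[>] (0 : ℝ) ×ˢ 𝓝[>] (0 : ℝ))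

section Angle

variable {Y : Type u} [MetricSpace Y] {y : Y}

theorem comparisonAngle_nonneg (p q : Y) : 0 ≤ comparisonAngle y p q := Real.arccos_nonneg _

theorem comparisonAngle_le_pi (p q : Y) : comparisonAngle y p q ≤ Real.pi := Real.arccos_le_pi _

theorem comparisonAngle_comm (p q : Y) : comparisonAngle y p q = comparisonAngle y q p := by
  unfold comparisonAngle
  rw [dist_comm p q, add_comm (dist y p ^ 2), mul_right_comm]

theorem dist_lt_of_comparisonAngle_lt {p q : Y} {a : ℝ} (hp : 0 < dist y p) (hq : 0 < dist y q)
    (h0 : 0 ≤ a) (hpi : a ≤ Real.pi) (h : comparisonAngle y p q < a) :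
    dist p q < sideLength (dist y p) (dist y q) a := by
  have hc : Real.cos a <
      (dist y p ^ 2 + dist y q ^ 2 - dist p q ^ 2) / (2 * dist y p * dist y q) := by
    by_contra! hle
    have := Real.antitone_arccos hle
    rw [Real.arccos_cos h0 hpi] at this
    exact absurd h (not_lt.mpr this)
  rw [lt_div_iff₀ (by positivity)] at hc
  apply Real.lt_sqrt_of_sq_lt
  linarith

theorem lt_dist_of_lt_comparisonAngle {p q : Y} {a : ℝ} (hp : 0 < dist y p) (hq : 0 < dist y q)
    (h0 : 0 ≤ a) (hpi : a ≤ Real.pi) (h : a < comparisonAngle y p q) :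
    sideLength (dist y p) (dist y q) a < dist p q := by
  have hc : (dist y p ^ 2 + dist y q ^ 2 - dist p q ^ 2) / (2 * dist y p * dist y q) <
      Real.cos a := by
    by_contra! hle
    have := Real.antitone_arccos hle
    rw [Real.arccos_cos h0 hpi] at this
    exact absurd h (not_lt.mpr this)
  rw [div_lt_iff₀ (by positivity)] at hc
  rw [sideLength, Real.sqrt_lt (radicand_nonneg _ _ _) dist_nonneg]
  linarith

theorem GeodesicFrom.dist_start (γ : GeodesicFrom y) {t : ℝ} (h0 : 0 ≤ t) (h1 : t ≤ γ.length) :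
    dist y (γ.toFun t) = t := by
  have h : dist y (γ.toFun t) = dist (γ.toFun 0) (γ.toFun t) :=
    congrArg (fun z => dist z (γ.toFun t)) γ.start.symm
  rw [h, γ.isGeodesicOn 0 ⟨le_rfl, γ.length_pos.le⟩ t ⟨h0, h1⟩, zero_sub, abs_neg, abs_of_nonneg h0]

theorem angle_isBoundedUnder (γ γ' : GeodesicFrom y) :
    Filter.IsBoundedUnder (· ≤ ·) (𝓝[>] (0 : ℝ) ×ˢ 𝓝[>] (0 : ℝ))
      (fun q : ℝ × ℝ => comparisonAngle y (γ.toFun q.1) (γ'.toFun q.2)) :=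
  Filter.isBoundedUnder_of ⟨Real.pi, fun _ => comparisonAngle_le_pi _ _⟩

theorem angle_isCoboundedUnder (γ γ' : GeodesicFrom y) :
    Filter.IsCoboundedUnder (· ≤ ·) (𝓝[>] (0 : ℝ) ×ˢ 𝓝[>] (0 : ℝ))
      (fun q : ℝ × ℝ => comparisonAngle y (γ.toFun q.1) (γ'.toFun q.2)) :=
  (Filter.isBoundedUnder_of ⟨0, fun _ => comparisonAngle_nonneg _ _⟩ :
    Filter.IsBoundedUnder (· ≥ ·) _ _).isCoboundedUnder_le

theorem alexandroffAngle_nonneg (γ γ' : GeodesicFrom y) : 0 ≤ alexandroffAngle γ γ' :=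
  Filter.le_limsup_of_frequently_le
    (Filter.Frequently.of_forall fun _ => comparisonAngle_nonneg _ _) (angle_isBoundedUnder γ γ')

theorem alexandroffAngle_le_pi (γ γ' : GeodesicFrom y) : alexandroffAngle γ γ' ≤ Real.pi :=
  Filter.limsup_le_of_le (angle_isCoboundedUnder γ γ')
    (Filter.Eventually.of_forall fun _ => comparisonAngle_le_pi _ _)

theorem eventually_small {L : ℝ} (hL : 0 < L) : ∀ᶠ t in 𝓝[>] (0 : ℝ), 0 < t ∧ t < L :=
  Ioo_mem_nhdsGT hL

theorem alexandroffAngle_self (γ : GeodesicFrom y) : alexandroffAngle γ γ = 0 := by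
  have h : ∀ᶠ q : ℝ × ℝ in 𝓝[>] (0 : ℝ) ×ˢ 𝓝[>] (0 : ℝ),
      comparisonAngle y (γ.toFun q.1) (γ.toFun q.2) = 0 := by
    filter_upwards [(eventually_small γ.length_pos).prod_mk (eventually_small γ.length_pos)]
      with q hq
    obtain ⟨⟨h1, h1'⟩, h2, h2'⟩ := hq
    rw [comparisonAngle, γ.dist_start h1.le h1'.le, γ.dist_start h2.le h2'.le,
      γ.isGeodesicOn _ ⟨h1.le, h1'.le⟩ _ ⟨h2.le, h2'.le⟩, sq_abs, Real.arccos_eq_zero,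
      le_div_iff₀ (by positivity)]
    linarith [sq_nonneg (q.1 - q.2)]
  rw [alexandroffAngle, Filter.limsup_congr h, Filter.limsup_const]

theorem alexandroffAngle_comm (γ γ' : GeodesicFrom y) :
    alexandroffAngle γ γ' = alexandroffAngle γ' γ := by
  unfold alexandroffAngle
  conv_lhs => rw [Filter.prod_comm]
  unfold Filter.limsup
  rw [Filter.map_map]
  congr 2
  funext q
  exact comparisonAngle_comm _ _

theorem alexandroffAngle_triangle (γ₁ γ₂ γ₃ : GeodesicFrom y) :
    alexandroffAngle γ₁ γ₃ ≤ alexandroffAngle γ₁ γ₂ + alexandroffAngle γ₂ γ₃ := by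
  by_contra! hlt
  set A := alexandroffAngle γ₁ γ₂ with hA
  set B := alexandroffAngle γ₂ γ₃ with hB
  set D := alexandroffAngle γ₁ γ₃ with hD
  have hA0 : 0 ≤ A := alexandroffAngle_nonneg _ _
  have hB0 : 0 ≤ B := alexandroffAngle_nonneg _ _
  have hDp : D ≤ Real.pi := alexandroffAngle_le_pi _ _
  set δ := (D - A - B) / 4 with hδ
  have hδ0 : 0 < δ := by rw [hδ]; linarith
  have hsum : (A + δ) + (B + δ) < D := by rw [hδ]; linarith
  have e1 := Filter.eventually_lt_of_limsup_lt (show alexandroffAngle γ₁ γ₂ < A + δ by linarith)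
    (angle_isBoundedUnder γ₁ γ₂)
  have e2 := Filter.eventually_lt_of_limsup_lt (show alexandroffAngle γ₂ γ₃ < B + δ by linarith)
    (angle_isBoundedUnder γ₂ γ₃)
  have e3 := Filter.frequently_lt_of_lt_limsup (angle_isCoboundedUnder γ₁ γ₃)
    (show (A + δ) + (B + δ) < alexandroffAngle γ₁ γ₃ by linarith)
  have hbasis := (nhdsGT_basis (0 : ℝ)).prod_self
  obtain ⟨ε₁, hε₁, H1⟩ := hbasis.eventually_iff.mp e1
  obtain ⟨ε₂, hε₂, H2⟩ := hbasis.eventually_iff.mp e2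
  have hε : 0 < min (min ε₁ ε₂) (min γ₁.length (min γ₂.length γ₃.length)) :=
    lt_min (lt_min hε₁ hε₂) (lt_min γ₁.length_pos (lt_min γ₂.length_pos γ₃.length_pos))
  obtain ⟨⟨t, t''⟩, hq, ⟨ht, ht'⟩, hs, hs'⟩ :=
    (e3.and_eventually ((eventually_small hε).prod_mk (eventually_small hε))).exists
  simp only [lt_min_iff] at hq ht ht' hs hs'
  obtain ⟨b, hb, hbm, hadd⟩ := exists_sideLength_add ht hs
    (show 0 < A + δ by linarith) (show 0 < B + δ by linarith) (by linarith)
  have hb' : b < min (min ε₁ ε₂) (min γ₁.length (min γ₂.length γ₃.length)) :=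
    lt_of_le_of_lt hbm (max_lt (by simp only [lt_min_iff]; exact ht')
      (by simp only [lt_min_iff]; exact hs'))
  simp only [lt_min_iff] at hb'
  have d1 := γ₁.dist_start ht.le ht'.2.1.le
  have d2 := γ₂.dist_start hb.le hb'.2.2.1.le
  have d3 := γ₃.dist_start hs.le hs'.2.2.2.le
  have k1 := dist_lt_of_comparisonAngle_lt (y := y) (p := γ₁.toFun t) (q := γ₂.toFun b)
    (a := A + δ) (by rw [d1]; exact ht) (by rw [d2]; exact hb) (by linarith) (by linarith)
    (H1 (x := (t, b)) ⟨⟨ht, ht'.1.1⟩, ⟨hb, hb'.1.1⟩⟩)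
  have k2 := dist_lt_of_comparisonAngle_lt (y := y) (p := γ₂.toFun b) (q := γ₃.toFun t'')
    (a := B + δ) (by rw [d2]; exact hb) (by rw [d3]; exact hs) (by linarith) (by linarith)
    (H2 (x := (b, t'')) ⟨⟨hb, hb'.1.2⟩, ⟨hs, hs'.1.2⟩⟩)
  have k3 := lt_dist_of_lt_comparisonAngle (y := y) (p := γ₁.toFun t) (q := γ₃.toFun t'')
    (by rw [d1]; exact ht) (by rw [d3]; exact hs) (by linarith) (by linarith) hq
  rw [d1, d2] at k1
  rw [d2, d3] at k2
  rw [d1, d3, hadd] at k3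
  linarith [dist_triangle (γ₁.toFun t) (γ₂.toFun b) (γ₃.toFun t'')]

end Angle

/-- The Alexandroff angle is a pseudometric on the geodesic segments issuing from `y`. -/
instance {Y : Type u} [MetricSpace Y] (y : Y) : PseudoMetricSpace (GeodesicFrom y) where
  dist := alexandroffAngle
  dist_self := alexandroffAngle_self
  dist_comm := alexandroffAngle_comm
  dist_triangle := alexandroffAngle_triangle

/-- The space of directions at `y`: geodesic segments issuing from `y`, where segments at angle
zero are identified, with the Alexandroff angle as metric. -/
abbrev SpaceOfDirections {Y : Type u} [MetricSpace Y] (y : Y) : Type u :=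
  SeparationQuotient (GeodesicFrom y)

/-! ### Infinite cones and tangent cones -/

/-- The infinite cone over `S`: the apex and the points `a • ξ` with `a > 0` and `ξ ∈ S`. -/
inductive InfiniteCone (S : Type u) : Type u
  | apex : InfiniteCone S
  | point (a : ℝ) (ha : 0 < a) (ξ : S) : InfiniteCone S

namespace InfiniteCone

variable {S : Type u}

/-- The distance from the apex. -/
def radius : InfiniteCone S → ℝ
  | apex => 0
  | point a _ _ => a

theorem radius_nonneg (x : InfiniteCone S) : 0 ≤ radius x := by
  cases x with
  | apex => exact le_rfl
  | point a ha ξ => exact ha.le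

variable [MetricSpace S]

/-- The angle at the apex between two points other than the apex, cut off at `π` as usual
(angles of directions never exceed `π`); the value is irrelevant if one of them is the apex. -/
def angle : InfiniteCone S → InfiniteCone S → ℝ
  | point _ _ ξ, point _ _ η => min (dist ξ η) Real.pi
  | _, _ => 0

theorem angle_nonneg (x x' : InfiniteCone S) : 0 ≤ angle x x' := by
  cases x <;> cases x' <;> simp [angle, Real.pi_pos.le]

theorem angle_le_pi (x x' : InfiniteCone S) : angle x x' ≤ Real.pi := by
  cases x <;> cases x' <;> simp [angle, Real.pi_pos.le]

theorem sideLength_zero_left (b s t : ℝ) : sideLength 0 b s = sideLength 0 b t := by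
  simp [sideLength]

theorem sideLength_zero_right (a s t : ℝ) : sideLength a 0 s = sideLength a 0 t := by
  simp [sideLength]

/-- The metric of the infinite cone, `√(a² + b² - 2ab cos θ)` where `θ` is the distance in `S`. -/
instance : MetricSpace (InfiniteCone S) where
  dist x x' := sideLength (radius x) (radius x') (angle x x')
  dist_self x := by
    have h : angle x x = 0 := by cases x <;> simp [angle, Real.pi_pos.le]
    have h2 : radius x ^ 2 + radius x ^ 2 - 2 * radius x * radius x * 1 = 0 := by ring
    rw [h, sideLength, Real.cos_zero, h2, Real.sqrt_zero]
  dist_comm x x' := by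
    have h : angle x x' = angle x' x := by cases x <;> cases x' <;> simp [angle, dist_comm]
    rw [h, sideLength_comm]
  dist_triangle x x' x'' := by
    have hx := radius_nonneg x
    have hx' := radius_nonneg x'
    have hx'' := radius_nonneg x''
    have main : ∀ t, 0 ≤ t → t ≤ Real.pi → t ≤ angle x x' + angle x' x'' →
        sideLength (radius x) (radius x'') t ≤
          sideLength (radius x) (radius x') (angle x x') +
            sideLength (radius x') (radius x'') (angle x' x'') := fun t h0 h1 h =>
      sideLength_triangle hx hx' hx'' (angle_le_pi _ _) (angle_nonneg _ _) (angle_le_pi _ _)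
        h0 h1 h
    rcases x with _ | ⟨a, ha, ξ⟩
    · refine le_trans (le_of_eq (sideLength_zero_left _ _ _))
        (main (angle x' x'') (angle_nonneg _ _) (angle_le_pi _ _) ?_)
      linarith [angle_nonneg apex x']
    rcases x'' with _ | ⟨c, hc, ζ⟩
    · refine le_trans (le_of_eq (sideLength_zero_right _ _ _))
        (main (angle (point a ha ξ) x') (angle_nonneg _ _) (angle_le_pi _ _) ?_)
      linarith [angle_nonneg x' apex]
    rcases x' with _ | ⟨b, hb, η⟩
    · have h := sideLength_triangle (a := a) (b := 0) (c := c) (r := Real.pi) (s := 0)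
        (t := angle (point a ha ξ) (point c hc ζ)) ha.le le_rfl hc.le le_rfl le_rfl
        Real.pi_pos.le (angle_nonneg _ _) (angle_le_pi _ _) (by
          rw [add_zero]; exact angle_le_pi _ _)
      rw [sideLength_zero_right a Real.pi 0] at h
      exact h
    · refine main _ (angle_nonneg _ _) (angle_le_pi _ _) ?_
      simp only [angle]
      have hpi := Real.pi_pos.le
      have h1 := dist_triangle ξ η ζ
      have h2 : 0 ≤ dist ξ η := dist_nonneg
      have h3 : 0 ≤ dist η ζ := dist_nonneg
      rcases min_cases (dist ξ η) Real.pi with ⟨e, _⟩ | ⟨e, _⟩ <;>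
        rcases min_cases (dist η ζ) Real.pi with ⟨e', _⟩ | ⟨e', _⟩ <;>
        rcases min_cases (dist ξ ζ) Real.pi with ⟨e'', _⟩ | ⟨e'', _⟩ <;>
        rw [e, e', e''] <;> linarith
  eq_of_dist_eq_zero {x x'} h := by
    have h' : sideLength (radius x) (radius x') (angle x x') = 0 := h
    rw [sideLength, Real.sqrt_eq_zero (radicand_nonneg _ _ _)] at h'
    rcases x with _ | ⟨a, ha, ξ⟩ <;> rcases x' with _ | ⟨b, hb, η⟩
    · rfl
    · simp only [radius] at h'
      nlinarith
    · simp only [radius] at h'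
      nlinarith
    · have hle : Real.cos (angle (point a ha ξ) (point b hb η)) ≤ 1 := Real.cos_le_one _
      simp only [radius] at h'
      have hab : 0 < a * b := mul_pos ha hb
      have hsq : (a - b) ^ 2 = 0 := by nlinarith [sq_nonneg (a - b)]
      have e : a = b := by
        have := pow_eq_zero_iff (two_ne_zero) |>.mp hsq
        linarith
      have hcos : Real.cos (angle (point a ha ξ) (point b hb η)) = 1 := by nlinarith
      have hang : angle (point a ha ξ) (point b hb η) = 0 :=
        Real.injOn_cos ⟨angle_nonneg _ _, angle_le_pi _ _⟩ ⟨le_rfl, Real.pi_pos.le⟩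
          (by rw [hcos, Real.cos_zero])
      have hd : dist ξ η = 0 := by
        simp only [angle] at hang
        rcases min_choice (dist ξ η) Real.pi with e1 | e1
        · rw [← e1, hang]
        · rw [e1] at hang
          exact absurd hang Real.pi_pos.ne'
      have := eq_of_dist_eq_zero hd
      subst e this
      rfl

end InfiniteCone

/-- The tangent cone of `Y` at `y`: the infinite cone over the space of directions at `y`. -/
abbrev TangentCone {Y : Type u} [MetricSpace Y] (y : Y) : Type u :=
  InfiniteCone (SpaceOfDirections y)

end WangTrick

end

/-! The bound in terms of tangent cones is Wang's trick. For a chain on `V` and `f : V → Y`, let `y`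
be a barycenter of `f`, that is, a minimum point of the mean square distance from the values of `f`;
it exists because `Y` is complete and the Bruhat–Tits inequality makes this function uniformly
convex. Compare `f` with its logarithm at `y`, which takes values in the tangent cone.

The logarithm keeps distances from `y` and does not increase other distances, since Alexandroff
angles are at most comparison angles (`IsCAT0.dist_log_le`). So the energy does not grow. The spread
cannot collapse: by the first variation inequality, minimality of `y` says that the logarithm of `f`
has nonpositive mean inner product with every direction (`IsCAT0.sum_cos_angle_log_nonpos`).
Expanding squares in the cone, the spread of the logarithm is at least twice the mean square
distance of `f` from `y`, while the triangle inequality bounds the spread of `f` by four times that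
quantity. Hence a Poincaré inequality in the tangent cone with constant `L` gives one in `Y` with
constant `2 * L`. The local version follows because the logarithm does not increase the number of
values.

For the manifold it remains to show that tangent cones satisfy the Poincaré inequality of Hilbert
spaces, with constant `1 / √σ`. The cone need not be identified with a Hilbert space: its metric is
the limit of rescaled metrics of `M`, and near each point a linearised chart is bi-Lipschitz with
constants arbitrarily close to `1`, so the inequality passes to the limit
(`IsCAT0.poincareModulus_tangentCone_le`). The Hilbert inequality itself
(`ReversibleChain.mul_spread_le_energy`) is the positivity of a symmetric matrix whose spectrum is
controlled by the gap. The lower bound is attained by a two-point chain with flip probability `σ /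
2`. -/

noncomputable section

namespace WangTrick

universe u

/-! ### Finite chains and the Poincaré inequality in inner product spaces -/

section Chains

namespace ReversibleChain

variable {V : Type} [Fintype V] [DecidableEq V] (C : ReversibleChain V)

/-- The mean square distance of two independent values of `f`. -/
def spread {Y : Type u} [MetricSpace Y] (f : V → Y) : ℝ :=
  ∑ u, ∑ v, C.ν u * C.ν v * dist (f u) (f v) ^ 2

/-- The mean square distance of the values of `f` at the two ends of a random transition. -/
def energy {Y : Type u} [MetricSpace Y] (f : V → Y) : ℝ :=
  ∑ u, ∑ v, C.ν u * C.P u v * dist (f u) (f v) ^ 2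

theorem reversible_pow (n : ℕ) (u v : V) : C.ν u * (C.P ^ n) u v = C.ν v * (C.P ^ n) v u := by
  induction n generalizing u v with
  | zero =>
    by_cases h : u = v
    · rw [h]
    · simp [Matrix.one_apply_ne h, Matrix.one_apply_ne (Ne.symm h)]
  | succ n ih =>
    rw [pow_succ, Matrix.mul_apply, ← pow_succ, pow_succ', Matrix.mul_apply, Finset.mul_sum,
      Finset.mul_sum]
    refine Finset.sum_congr rfl fun w _ => ?_
    rw [← mul_assoc, ih, mul_right_comm, C.reversible w v]
    ring

/-- Some state has positive mass; ergodicity and reversibility carry it to every other state. This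
permits division by `√(C.ν v)`. -/
theorem ν_pos (v : V) : 0 < C.ν v := by
  obtain ⟨u, -, hu⟩ : ∃ u ∈ Finset.univ, 0 < C.ν u := by
    apply Finset.exists_lt_of_sum_lt
    simp [C.ν_sum]
  obtain ⟨n, -, hn⟩ := C.ergodic u v
  have h := C.reversible_pow n u v
  refine (C.ν_nonneg v).lt_of_ne fun h0 => ?_
  rw [← h0, zero_mul] at h
  exact (mul_pos hu hn).ne' h

theorem pow_nonneg_apply (n : ℕ) (u v : V) : 0 ≤ (C.P ^ n) u v := by
  induction n generalizing u v with
  | zero => rw [pow_zero, Matrix.one_apply]; split_ifs <;> norm_num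
  | succ n ih =>
    rw [pow_succ, Matrix.mul_apply]
    exact Finset.sum_nonneg fun w _ => mul_nonneg (ih _ _) (C.P_nonneg _ _)

theorem pow_sum (n : ℕ) (u : V) : ∑ v, (C.P ^ n) u v = 1 := by
  induction n generalizing u with
  | zero => simp [Matrix.one_apply]
  | succ n ih =>
    simp_rw [pow_succ', Matrix.mul_apply]
    rw [Finset.sum_comm]
    simp_rw [← Finset.mul_sum, ih, mul_one]
    exact C.P_sum u

/-- Harmonic functions are constant. -/
theorem harmonic_const {x : V → ℝ} (hx : C.P.mulVec x = x) (u v : V) : x u = x v := by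
  have : Nonempty V := ⟨u⟩
  obtain ⟨m, hm⟩ := Finite.exists_max x
  suffices h : ∀ v, x v = x m by rw [h u, h v]
  intro v
  obtain ⟨n, -, hn⟩ := C.ergodic m v
  have hpow : (C.P ^ n).mulVec x = x := by
    clear hn
    induction n with
    | zero => simp
    | succ n ih => rw [pow_succ, ← Matrix.mulVec_mulVec, hx, ih]
  -- Maximum principle: all terms are nonnegative, so each vanishes, and the weight of the term at
  -- `v` is positive.
  have h0 : ∑ w, (C.P ^ n) m w * (x m - x w) = 0 := by
    simp_rw [mul_sub, Finset.sum_sub_distrib, ← Finset.sum_mul, C.pow_sum, one_mul]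
    have := congrFun hpow m
    simp only [Matrix.mulVec, dotProduct] at this
    linarith
  have h1 := (Finset.sum_eq_zero_iff_of_nonneg fun w _ =>
    mul_nonneg (C.pow_nonneg_apply n m w) (sub_nonneg.mpr (hm w))).mp h0 v (Finset.mem_univ v)
  rcases mul_eq_zero.mp h1 with h | h <;> linarith

theorem spectralGap_le {r : ℝ} {x : V → ℝ} (hx : x ≠ 0) (h : C.P.mulVec x = r • x)
    (hr : r ≠ 1) : C.spectralGap ≤ ((1 - r : ℝ) : EReal) := by
  refine iInf₂_le r ⟨?_, hr⟩
  rw [Module.End.hasEigenvalue_iff, Submodule.ne_bot_iff]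
  exact ⟨x, by rw [Module.End.mem_eigenspace_iff, Matrix.toLin'_apply, h], hx⟩

/-- The matrix of the quadratic form `energy - σ * spread` in an orthonormal basis. -/
def poincareMatrix (σ : ℝ) : Matrix V V ℝ := fun u v =>
  (if u = v then 1 - σ else 0) - √(C.ν u) * C.P u v / √(C.ν v) + σ * (√(C.ν u) * √(C.ν v))

theorem poincareMatrix_isHermitian (σ : ℝ) : (C.poincareMatrix σ).IsHermitian := by
  ext u v
  simp only [Matrix.conjTranspose_apply, star_trivial, poincareMatrix]
  have hu := Real.sqrt_pos.mpr (C.ν_pos u)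
  have hv := Real.sqrt_pos.mpr (C.ν_pos v)
  have h : √(C.ν v) * C.P v u / √(C.ν u) = √(C.ν u) * C.P u v / √(C.ν v) := by
    rw [div_eq_div_iff hu.ne' hv.ne']
    have := C.reversible u v
    rw [← Real.mul_self_sqrt (C.ν_nonneg u), ← Real.mul_self_sqrt (C.ν_nonneg v)] at this
    linarith
  rw [h, mul_comm √(C.ν v) √(C.ν u)]
  simp only [eq_comm]

theorem poincareMatrix_mulVec (σ : ℝ) (x : V → ℝ) (u : V) :
    (C.poincareMatrix σ).mulVec x u = (1 - σ) * x u -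
      √(C.ν u) * (∑ v, C.P u v * (x v / √(C.ν v))) + σ * √(C.ν u) * ∑ v, √(C.ν v) * x v := by
  have h : ∀ v, C.poincareMatrix σ u v * x v = (if u = v then (1 - σ) * x v else 0) -
      √(C.ν u) * (C.P u v * (x v / √(C.ν v))) + σ * √(C.ν u) * (√(C.ν v) * x v) := by
    intro v
    simp only [poincareMatrix]
    split_ifs <;> ring
  simp only [Matrix.mulVec, dotProduct, h, Finset.sum_add_distrib, Finset.sum_sub_distrib,
    ← Finset.mul_sum]
  simp

/-- The vector `√ν` lies in the kernel, so an eigenvector `x` with eigenvalue `l < 0` is orthogonal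
to it. Then `x / √ν` is an eigenfunction of `P` with eigenvalue `1 - σ - l`. If this is `1`, the
function is constant, against orthogonality; otherwise the gap is at most `σ + l < σ`. -/
theorem poincareMatrix_posSemidef {σ : ℝ} (hgap : (σ : EReal) ≤ C.spectralGap) :
    (C.poincareMatrix σ).PosSemidef := by
  have hH := C.poincareMatrix_isHermitian σ
  rw [hH.posSemidef_iff_eigenvalues_nonneg]
  intro i
  by_contra! hneg
  change hH.eigenvalues i < 0 at hneg
  set l := hH.eigenvalues i with hl
  set x : V → ℝ := (hH.eigenvectorBasis i).ofLp with hxdef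
  have hx0 : x ≠ 0 := by
    intro h
    apply (hH.eigenvectorBasis.toBasis.ne_zero i)
    rw [OrthonormalBasis.coe_toBasis]
    ext j
    exact congrFun h j
  have hxe : (C.poincareMatrix σ).mulVec x = l • x := hH.mulVec_eigenvectorBasis i
  have hpos := fun v => Real.sqrt_pos.mpr (C.ν_pos v)
  have hw : (C.poincareMatrix σ).mulVec (fun v => √(C.ν v)) = 0 := by
    ext u
    have h1 : ∀ v, C.P u v * (√(C.ν v) / √(C.ν v)) = C.P u v := fun v => by
      rw [div_self (hpos v).ne', mul_one]
    rw [poincareMatrix_mulVec]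
    simp only [h1, C.P_sum, Real.mul_self_sqrt (C.ν_nonneg _), C.ν_sum, Pi.zero_apply]
    ring
  have horth : ∑ v, √(C.ν v) * x v = 0 := by
    have h1 : (fun v => √(C.ν v)) ⬝ᵥ (C.poincareMatrix σ).mulVec x = 0 := by
      rw [Matrix.dotProduct_mulVec, ← Matrix.mulVec_transpose]
      have : (C.poincareMatrix σ).transpose = C.poincareMatrix σ := by
        simpa [Matrix.IsHermitian, Matrix.conjTranspose_eq_transpose_of_trivial] using hH
      rw [this, hw, zero_dotProduct]
    rw [hxe, dotProduct_smul, smul_eq_mul] at h1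
    exact (mul_eq_zero.mp h1).resolve_left hneg.ne
  have hP : C.P.mulVec (fun v => x v / √(C.ν v)) = (1 - σ - l) • fun v => x v / √(C.ν v) := by
    ext u
    have h1 := congrFun hxe u
    rw [poincareMatrix_mulVec, horth] at h1
    simp only [Matrix.mulVec, dotProduct, Pi.smul_apply, smul_eq_mul] at h1 ⊢
    have := (hpos u).ne'
    rw [← mul_div_assoc, eq_div_iff this]
    linarith
  have hne : (fun v => x v / √(C.ν v)) ≠ 0 := by
    intro h
    apply hx0
    ext v
    have := congrFun h v
    simpa [(hpos v).ne'] using this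
  by_cases hr : 1 - σ - l = 1
  · rw [hr, one_smul] at hP
    obtain ⟨v₀, hv₀⟩ := Function.ne_iff.mp hne
    apply hv₀
    have h1 : ∀ v, √(C.ν v) * x v = C.ν v * (x v₀ / √(C.ν v₀)) := by
      intro v
      have h2 : x v / √(C.ν v) = x v₀ / √(C.ν v₀) := C.harmonic_const hP v v₀
      rw [← h2, ← mul_div_assoc, eq_div_iff (hpos v).ne']
      nth_rw 3 [← Real.mul_self_sqrt (C.ν_nonneg v)]
      ring
    simp only [h1, ← Finset.sum_mul, C.ν_sum, one_mul] at horth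
    exact horth
  · have h1 := hgap.trans (C.spectralGap_le hne hP hr)
    rw [EReal.coe_le_coe_iff] at h1
    linarith

/-- Writing `A` as `Bᴴ * B` turns the sum into a sum of squared norms. This passes from scalar to
vector values without coordinates in `F`, whatever its dimension. -/
theorem sum_inner_nonneg_of_posSemidef {F : Type*} [NormedAddCommGroup F] [InnerProductSpace ℝ F]
    {A : Matrix V V ℝ} (hA : A.PosSemidef) (f : V → F) :
    0 ≤ ∑ u, ∑ v, A u v * inner ℝ (f u) (f v) := by
  obtain ⟨B, rfl⟩ : ∃ B : Matrix V V ℝ, A = B.conjTranspose * B := by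
    open scoped MatrixOrder in
    obtain ⟨B, hB⟩ := CStarAlgebra.nonneg_iff_eq_star_mul_self.mp hA.nonneg
    exact ⟨B, hB⟩
  have h : ∑ u, ∑ v, (B.conjTranspose * B) u v * inner ℝ (f u) (f v) =
      ∑ w, ‖∑ u, B w u • f u‖ ^ 2 := by
    simp only [← real_inner_self_eq_norm_sq, sum_inner, inner_sum, Matrix.mul_apply,
      Matrix.conjTranspose_apply, star_trivial, Finset.sum_mul, real_inner_smul_left,
      real_inner_smul_right]
    rw [Finset.sum_comm_cycle]
    refine Finset.sum_congr rfl fun w _ => Finset.sum_congr rfl fun u _ =>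
      Finset.sum_congr rfl fun v _ => ?_
    rw [real_inner_comm]
    ring
  rw [h]
  positivity

/-- The Poincaré inequality for maps to a real inner product space. -/
theorem mul_spread_le_energy {F : Type*} [NormedAddCommGroup F] [InnerProductSpace ℝ F]
    {σ : ℝ} (hgap : (σ : EReal) ≤ C.spectralGap) (f : V → F) :
    σ * C.spread f ≤ C.energy f := by
  have hpos := fun v => Real.sqrt_pos.mpr (C.ν_pos v)
  -- The weights `√ν` undo the normalisation of the matrix; the resulting form is half of energy
  -- minus `σ` times spread.
  have h := sum_inner_nonneg_of_posSemidef (C.poincareMatrix_posSemidef hgap)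
    fun u => √(C.ν u) • f u
  have h1 : ∀ u v, C.poincareMatrix σ u v * inner ℝ (√(C.ν u) • f u) (√(C.ν v) • f v) =
      (if u = v then (1 - σ) * C.ν u * ‖f u‖ ^ 2 else 0) - C.ν u * C.P u v * inner ℝ (f u) (f v) +
      σ * (C.ν u * C.ν v * inner ℝ (f u) (f v)) := by
    intro u v
    rw [real_inner_smul_left, real_inner_smul_right]
    simp only [poincareMatrix]
    have e1 : √(C.ν u) * C.P u v / √(C.ν v) *
        (√(C.ν u) * (√(C.ν v) * inner ℝ (f u) (f v))) =
        C.ν u * C.P u v * inner ℝ (f u) (f v) := by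
      nth_rw 3 [← Real.mul_self_sqrt (C.ν_nonneg u)]
      have := (hpos v).ne'
      field_simp
    have e2 : √(C.ν u) * √(C.ν v) * (√(C.ν u) * (√(C.ν v) * inner ℝ (f u) (f v))) =
        C.ν u * C.ν v * inner ℝ (f u) (f v) := by
      nth_rw 3 [← Real.mul_self_sqrt (C.ν_nonneg u), ← Real.mul_self_sqrt (C.ν_nonneg v)]
      ring
    rw [add_mul, sub_mul, e1, mul_assoc σ, e2]
    split_ifs with huv
    · subst huv
      rw [← real_inner_self_eq_norm_sq]
      linear_combination (1 - σ) * inner ℝ (f u) (f u) * Real.mul_self_sqrt (C.ν_nonneg u)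
    · ring
  simp only [h1, Finset.sum_add_distrib, Finset.sum_sub_distrib, ← Finset.mul_sum,
    Finset.sum_ite_eq, Finset.mem_univ, if_true] at h
  have hd : ∀ u v, dist (f u) (f v) ^ 2 =
      ‖f u‖ ^ 2 - 2 * inner ℝ (f u) (f v) + ‖f v‖ ^ 2 := fun u v => by
    rw [dist_eq_norm, norm_sub_sq_real]
  have hs : C.spread f = 2 * ∑ u, C.ν u * ‖f u‖ ^ 2 -
      2 * ∑ u, ∑ v, C.ν u * C.ν v * inner ℝ (f u) (f v) := by
    have e : ∀ u v, C.ν u * C.ν v * dist (f u) (f v) ^ 2 = C.ν v * (C.ν u * ‖f u‖ ^ 2) +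
        C.ν u * (C.ν v * ‖f v‖ ^ 2) - 2 * (C.ν u * C.ν v * inner ℝ (f u) (f v)) := fun u v => by
      rw [hd]; ring
    simp only [spread, e, Finset.sum_add_distrib, Finset.sum_sub_distrib, ← Finset.mul_sum,
      ← Finset.sum_mul, C.ν_sum]
    ring
  have he : C.energy f = 2 * ∑ u, C.ν u * ‖f u‖ ^ 2 -
      2 * ∑ u, ∑ v, C.ν u * C.P u v * inner ℝ (f u) (f v) := by
    have e : ∀ u v, C.ν u * C.P u v * dist (f u) (f v) ^ 2 = C.P u v * (C.ν u * ‖f u‖ ^ 2) +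
        C.P v u * (C.ν v * ‖f v‖ ^ 2) - 2 * (C.ν u * C.P u v * inner ℝ (f u) (f v)) :=
      fun u v => by
        rw [hd]
        linear_combination ‖f v‖ ^ 2 * C.reversible u v
    have e2 : ∑ u, ∑ v, C.P v u * (C.ν v * ‖f v‖ ^ 2) = ∑ u, C.ν u * ‖f u‖ ^ 2 := by
      rw [Finset.sum_comm]
      simp only [← Finset.sum_mul, C.P_sum, one_mul]
    simp only [energy, e, Finset.sum_add_distrib, Finset.sum_sub_distrib, e2, ← Finset.mul_sum]
    simp only [← Finset.sum_mul, C.P_sum, one_mul]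
    ring
  simp only [mul_assoc, ← Finset.mul_sum] at h hs he ⊢
  rw [hs, he]
  linarith

theorem spread_nonneg {Y : Type u} [MetricSpace Y] (f : V → Y) : 0 ≤ C.spread f :=
  Finset.sum_nonneg fun u _ => Finset.sum_nonneg fun v _ =>
    mul_nonneg (mul_nonneg (C.ν_nonneg u) (C.ν_nonneg v)) (sq_nonneg _)

end ReversibleChain

/-! ### The Poincaré modulus of exponent two -/

theorem poincareModulus_two (Y : Type u) [MetricSpace Y] (σ : ℝ) :
    poincareModulus 2 Y σ = sInf {L : ℝ≥0∞ | ∀ (V : Type) [Fintype V] [DecidableEq V]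
      (C : ReversibleChain V), (σ : EReal) ≤ C.spectralGap → ∀ f : V → Y,
        ENNReal.ofReal (C.spread f) ≤ L ^ 2 * ENNReal.ofReal (C.energy f)} := by
  simp only [poincareModulus, Real.rpow_two, ENNReal.rpow_two, ReversibleChain.spread,
    ReversibleChain.energy]

/-- The strict inequality makes it unnecessary to know that the infimum in the definition is
attained. -/
theorem ofReal_spread_le_of_poincareModulus_lt {Y : Type u} [MetricSpace Y] {σ : ℝ} {L : ℝ≥0∞}
    (h : poincareModulus 2 Y σ < L) {V : Type} [Fintype V] [DecidableEq V]
    (C : ReversibleChain V) (hgap : (σ : EReal) ≤ C.spectralGap) (f : V → Y) :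
    ENNReal.ofReal (C.spread f) ≤ L ^ 2 * ENNReal.ofReal (C.energy f) := by
  rw [poincareModulus_two, sInf_lt_iff] at h
  obtain ⟨L', hL', hlt⟩ := h
  exact (hL' V C hgap f).trans (by gcongr)

theorem poincareModulus_two_le {Y : Type u} [MetricSpace Y] {σ : ℝ} {L : ℝ≥0∞}
    (h : ∀ (V : Type) [Fintype V] [DecidableEq V] (C : ReversibleChain V),
      (σ : EReal) ≤ C.spectralGap → ∀ f : V → Y,
        ENNReal.ofReal (C.spread f) ≤ L ^ 2 * ENNReal.ofReal (C.energy f)) :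
    poincareModulus 2 Y σ ≤ L := by
  rw [poincareModulus_two]
  exact sInf_le h

/-! ### The lower bound from two points -/

/-- The two-point chain whose state changes with probability `q`. -/
def flipChain (q : ℝ) (h0 : 0 < q) (h1 : q ≤ 1) : ReversibleChain Bool where
  P := Matrix.of fun u v => if u = v then 1 - q else q
  P_nonneg u v := by rw [Matrix.of_apply]; split_ifs <;> linarith
  P_sum u := by cases u <;> simp
  ν := fun _ => 1 / 2
  ν_nonneg _ := by norm_num
  ν_sum := by simp
  reversible u v := by simp only [Matrix.of_apply, eq_comm]
  ergodic u v := by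
    by_cases h : u = v
    · subst h
      -- One step does not suffice if `q = 1`, but the return probability after two steps is `(1 -
      -- q) ^ 2 + q ^ 2`.
      refine ⟨2, by norm_num, ?_⟩
      rw [sq, Matrix.mul_apply]
      cases u <;> simp <;> nlinarith [sq_nonneg (1 - q)]
    · exact ⟨1, le_rfl, by simpa [h] using h0⟩

/-- Adding the two coordinates of the eigenvalue equation shows that an eigenvector for `r ≠ 1` is
antisymmetric, so that `r = 1 - 2 * q`. -/
theorem le_spectralGap_flipChain (q : ℝ) (h0 : 0 < q) (h1 : q ≤ 1) :
    ((2 * q : ℝ) : EReal) ≤ (flipChain q h0 h1).spectralGap := by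
  refine le_iInf₂ fun r hr => ?_
  obtain ⟨x, hx⟩ := hr.1.exists_hasEigenvector
  have he := hx.apply_eq_smul
  rw [Matrix.toLin'_apply] at he
  have e1 := congrFun he true
  have e2 := congrFun he false
  simp only [Matrix.mulVec, dotProduct, flipChain, Matrix.of_apply, Fintype.sum_bool,
    Pi.smul_apply, smul_eq_mul, if_true, Bool.true_eq_false, Bool.false_eq_true, if_false] at e1 e2
  have hsum : (1 - r) * (x true + x false) = 0 := by linear_combination e1 + e2
  have hs : x true + x false = 0 :=
    (mul_eq_zero.mp hsum).resolve_left (sub_ne_zero.mpr hr.2.symm)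
  have hne : x true ≠ 0 := by
    intro h
    apply hx.2
    ext b
    cases b
    · simp only [Pi.zero_apply]; linarith
    · exact h
  have : (1 - 2 * q - r) * x true = 0 := by linear_combination e1 - q * hs
  have := (mul_eq_zero.mp this).resolve_right hne
  rw [EReal.coe_le_coe_iff]
  linarith

/-- For the flip chain with `q = σ / 2` and two distinct values, the energy is exactly `σ` times the
spread. The condition `σ ≤ 2` makes `q` a probability. -/
theorem ofReal_inv_sqrt_le_poincareModulus {Y : Type u} [MetricSpace Y] [Nontrivial Y] {σ : ℝ}
    (h0 : 0 < σ) (h2 : σ ≤ 2) : ENNReal.ofReal (1 / √σ) ≤ poincareModulus 2 Y σ := by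
  refine le_of_forall_gt fun L hL => ?_
  obtain ⟨x, y, hxy⟩ := exists_pair_ne Y
  -- The intermediate constant is finite, so that the computation takes place in `ℝ`, and it leaves
  -- room for the strict inequality.
  obtain ⟨L', hL', hLL⟩ := exists_between hL
  lift L' to NNReal using (hLL.trans_le le_top).ne
  have h := ofReal_spread_le_of_poincareModulus_lt hL' (flipChain (σ / 2) (by linarith)
    (by linarith)) (by
      have := le_spectralGap_flipChain (σ / 2) (by linarith) (by linarith)
      rwa [mul_div_cancel₀ _ (two_ne_zero' ℝ)] at this) (fun b => if b then x else y)
  have hs : (flipChain (σ / 2) (by linarith) (by linarith)).spread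
      (fun b => if b then x else y) = dist x y ^ 2 / 2 := by
    simp [ReversibleChain.spread, flipChain, dist_comm y x]
    ring
  have he : (flipChain (σ / 2) (by linarith) (by linarith)).energy
      (fun b => if b then x else y) = σ * (dist x y ^ 2 / 2) := by
    simp [ReversibleChain.energy, flipChain, dist_comm y x]
    ring
  have hd := dist_pos.mpr hxy
  rw [hs, he, ← ENNReal.ofReal_coe_nnreal, ← ENNReal.ofReal_pow (NNReal.coe_nonneg L'),
    ← ENNReal.ofReal_mul (by positivity), ENNReal.ofReal_le_ofReal_iff (by positivity)] at h
  refine lt_of_le_of_lt ?_ hLL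
  rw [← ENNReal.ofReal_coe_nnreal]
  apply ENNReal.ofReal_le_ofReal
  rw [div_le_iff₀ (Real.sqrt_pos.mpr h0)]
  have h3 : 1 ≤ ((L' : ℝ) * √σ) ^ 2 := by
    rw [mul_pow, Real.sq_sqrt h0.le]
    have : 0 < dist x y ^ 2 / 2 := by positivity
    by_contra! hlt
    nlinarith
  exact (one_le_sq_iff₀ (by positivity)).mp h3

end Chains

section CAT0

/-! ### Comparison angles in CAT(0) spaces -/

theorem sq_sideLength (a b θ : ℝ) :
    sideLength a b θ ^ 2 = a ^ 2 + b ^ 2 - 2 * a * b * Real.cos θ :=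
  Real.sq_sqrt (radicand_nonneg a b θ)

theorem sideLength_mul {t : ℝ} (ht : 0 ≤ t) (a b θ : ℝ) :
    sideLength (a * t) (b * t) θ = t * sideLength a b θ := by
  rw [sideLength, sideLength, show (a * t) ^ 2 + (b * t) ^ 2 - 2 * (a * t) * (b * t) * Real.cos θ =
    t ^ 2 * (a ^ 2 + b ^ 2 - 2 * a * b * Real.cos θ) by ring, Real.sqrt_mul (sq_nonneg t),
    Real.sqrt_sq ht]

theorem continuous_sideLength (a b : ℝ) : Continuous (sideLength a b) := by
  unfold sideLength
  fun_prop

variable {Y : Type u} [MetricSpace Y]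

/-- The law of cosines, multiplied out so that it survives degenerate triangles, where the quotient
in `comparisonAngle` divides by zero. Otherwise the triangle inequalities put the quotient in `[-1,
1]`. -/
theorem cos_comparisonAngle (y p q : Y) :
    2 * dist y p * dist y q * Real.cos (comparisonAngle y p q) =
      dist y p ^ 2 + dist y q ^ 2 - dist p q ^ 2 := by
  rcases eq_or_ne y p with rfl | hp
  · simp
  rcases eq_or_ne y q with rfl | hq
  · simp [dist_comm]
  have hp := dist_pos.mpr hp
  have hq := dist_pos.mpr hq
  have h1 := dist_triangle p y q
  have h2 := dist_triangle y p q
  have h3 := dist_triangle y q p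
  rw [dist_comm p y] at h1
  rw [dist_comm q p] at h3
  have h4 : 0 ≤ dist p q := dist_nonneg
  rw [comparisonAngle, Real.cos_arccos, mul_div_cancel₀ _ (by positivity)]
  · rw [le_div_iff₀ (by positivity)]
    nlinarith
  · rw [div_le_iff₀ (by positivity)]
    nlinarith

theorem sideLength_comparisonAngle (y p q : Y) :
    sideLength (dist y p) (dist y q) (comparisonAngle y p q) = dist p q := by
  rw [sideLength, cos_comparisonAngle, sub_sub_cancel, Real.sqrt_sq dist_nonneg]

theorem comparisonAngle_le_of_dist_le {y p q : Y} {θ : ℝ} (hp : 0 < dist y p)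
    (hq : 0 < dist y q) (h0 : 0 ≤ θ) (hpi : θ ≤ Real.pi)
    (h : dist p q ≤ sideLength (dist y p) (dist y q) θ) : comparisonAngle y p q ≤ θ := by
  by_contra! hlt
  exact absurd h (not_le.mpr (lt_dist_of_lt_comparisonAngle hp hq h0 hpi hlt))

theorem dist_lineMap_polar (a b s t θ : ℝ) :
    dist (AffineMap.lineMap (0 : EuclideanSpace ℝ (Fin 2)) !₂[a, 0] s)
      (AffineMap.lineMap (0 : EuclideanSpace ℝ (Fin 2)) !₂[b * Real.cos θ, b * Real.sin θ] t) =
      sideLength (s * a) (t * b) θ := by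
  rw [EuclideanSpace.dist_eq, sideLength]
  congr 1
  simp only [AffineMap.lineMap_apply, vsub_eq_sub, sub_zero, vadd_eq_add, add_zero,
    Fin.sum_univ_two, PiLp.smul_apply, smul_eq_mul, Real.dist_eq, sq_abs]
  simp
  linear_combination t ^ 2 * b ^ 2 * Real.sin_sq_add_cos_sq θ

theorem IsCAT0.dist_le_sideLength (hY : IsCAT0 Y) {x y z : Y} {γ γ' : ℝ → Y}
    (hγ : IsGeodesicFromTo γ x y) (hγ' : IsGeodesicFromTo γ' x z) {a b : ℝ}
    (ha : a ∈ Set.Icc (0 : ℝ) 1) (hb : b ∈ Set.Icc (0 : ℝ) 1) :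
    dist (γ (a * dist x y)) (γ' (b * dist x z)) ≤
      sideLength (a * dist x y) (b * dist x z) (comparisonAngle x y z) := by
  have h := fun s t => dist_lineMap_polar (dist x y) (dist x z) s t (comparisonAngle x y z)
  -- The reference triangle has its vertex at the origin, one side on the first axis and the other
  -- in polar form.
  have h1 := hY.comparison x y z γ γ' hγ hγ' 0 !₂[dist x y, 0]
    !₂[dist x z * Real.cos (comparisonAngle x y z), dist x z * Real.sin (comparisonAngle x y z)]
    (by
      have := dist_lineMap_polar (dist x y) 0 1 0 0
      simpa [sideLength, dist_comm] using this)
    (by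
      have := h 0 1
      simpa [sideLength] using this)
    (by
      have := h 1 1
      rw [one_mul, one_mul, sideLength_comparisonAngle] at this
      simpa using this) a ha b hb
  rwa [h] at h1

theorem GeodesicFrom.isGeodesicFromTo {y : Y} (γ : GeodesicFrom y) {t : ℝ} (h0 : 0 ≤ t)
    (h1 : t ≤ γ.length) : IsGeodesicFromTo γ.toFun y (γ.toFun t) where
  left := γ.start
  right := by rw [γ.dist_start h0 h1]
  isGeodesicOn := by
    rw [γ.dist_start h0 h1]
    exact fun s hs r hr => γ.isGeodesicOn s ⟨hs.1, hs.2.trans h1⟩ r ⟨hr.1, hr.2.trans h1⟩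

/-- Comparison angles along two geodesic segments are monotone in CAT(0) spaces. -/
theorem IsCAT0.comparisonAngle_mono (hY : IsCAT0 Y) {y : Y} (γ γ' : GeodesicFrom y)
    {s s' t t' : ℝ} (hs : 0 < s) (hss : s ≤ s') (hs' : s' ≤ γ.length)
    (ht : 0 < t) (htt : t ≤ t') (ht' : t' ≤ γ'.length) :
    comparisonAngle y (γ.toFun s) (γ'.toFun t) ≤
      comparisonAngle y (γ.toFun s') (γ'.toFun t') := by
  have h0 := hs.trans_le hss
  have h0' := ht.trans_le htt
  have d1 := γ.dist_start hs.le (hss.trans hs')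
  have d2 := γ'.dist_start ht.le (htt.trans ht')
  have h := hY.dist_le_sideLength (γ.isGeodesicFromTo h0.le hs') (γ'.isGeodesicFromTo h0'.le ht')
    (a := s / s') (b := t / t') ⟨by positivity, (div_le_one h0).mpr hss⟩
    ⟨by positivity, (div_le_one h0').mpr htt⟩
  rw [γ.dist_start h0.le hs', γ'.dist_start h0'.le ht', div_mul_cancel₀ _ h0.ne',
    div_mul_cancel₀ _ h0'.ne'] at h
  apply comparisonAngle_le_of_dist_le
  · rwa [d1]
  · rwa [d2]
  · exact comparisonAngle_nonneg _ _
  · exact comparisonAngle_le_pi _ _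
  · rwa [d1, d2]

/-- The Alexandroff angle is at most the comparison angle in CAT(0) spaces. -/
theorem IsCAT0.alexandroffAngle_le (hY : IsCAT0 Y) {y : Y} (γ γ' : GeodesicFrom y)
    {s t : ℝ} (hs : 0 < s) (hs' : s ≤ γ.length) (ht : 0 < t) (ht' : t ≤ γ'.length) :
    alexandroffAngle γ γ' ≤ comparisonAngle y (γ.toFun s) (γ'.toFun t) := by
  refine Filter.limsup_le_of_le (angle_isCoboundedUnder γ γ') ?_
  filter_upwards [(eventually_small hs).prod_mk (eventually_small ht)] with q hq
  exact hY.comparisonAngle_mono γ γ' hq.1.1 hq.1.2.le hs' hq.2.1 hq.2.2.le ht'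

/-- By monotonicity no comparison angle lies below the upper limit, which is therefore a limit. -/
theorem IsCAT0.tendsto_comparisonAngle (hY : IsCAT0 Y) {y : Y} (γ γ' : GeodesicFrom y) :
    Filter.Tendsto (fun q : ℝ × ℝ => comparisonAngle y (γ.toFun q.1) (γ'.toFun q.2))
      (𝓝[>] (0 : ℝ) ×ˢ 𝓝[>] (0 : ℝ)) (𝓝 (alexandroffAngle γ γ')) := by
  refine tendsto_order.mpr ⟨fun a ha => ?_, fun a ha => ?_⟩
  · filter_upwards [(eventually_small γ.length_pos).prod_mk (eventually_small γ'.length_pos)]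
      with q hq
    exact ha.trans_le (hY.alexandroffAngle_le γ γ' hq.1.1 hq.1.2.le hq.2.1 hq.2.2.le)
  · exact Filter.eventually_lt_of_limsup_lt ha (angle_isBoundedUnder γ γ')

/-! ### Barycenters -/

/-- Every two points of a CAT(0) space have a midpoint that satisfies the inequality of Bruhat
and Tits. -/
theorem IsCAT0.exists_midpoint (hY : IsCAT0 Y) (z w : Y) :
    ∃ m : Y, ∀ p : Y, dist p m ^ 2 ≤ (dist p z ^ 2 + dist p w ^ 2) / 2 - dist z w ^ 2 / 4 := by
  obtain ⟨γ, hγ⟩ := hY.geodesic z w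
  refine ⟨γ (1 / 2 * dist z w), fun p => ?_⟩
  obtain ⟨γ', hγ'⟩ := hY.geodesic z p
  -- The midpoint of one side is compared with the far end of the other; the law of cosines at `z`
  -- then gives the planar median formula.
  have h := hY.dist_le_sideLength hγ hγ' (a := 1 / 2) (b := 1) (by norm_num) (by norm_num)
  rw [one_mul, hγ'.right] at h
  have h2 := pow_le_pow_left₀ dist_nonneg h 2
  have h3 := cos_comparisonAngle z w p
  rw [sq_sideLength] at h2
  rw [dist_comm p, dist_comm p z, dist_comm p w]
  linarith

section Barycenter

variable {V : Type} [Fintype V] [DecidableEq V] (C : ReversibleChain V)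

/-- The mean square distance of a point from the values of `f`. -/
def ReversibleChain.meanSqDist (f : V → Y) (z : Y) : ℝ := ∑ u, C.ν u * dist (f u) z ^ 2

/-- The Bruhat–Tits inequality averaged over `ν`: uniform convexity of the mean square distance. -/
theorem IsCAT0.exists_meanSqDist_midpoint (hY : IsCAT0 Y) (f : V → Y) (z w : Y) :
    ∃ m, C.meanSqDist f m ≤
      (C.meanSqDist f z + C.meanSqDist f w) / 2 - dist z w ^ 2 / 4 := by
  obtain ⟨m, hm⟩ := hY.exists_midpoint z w
  refine ⟨m, ?_⟩
  have h : (C.meanSqDist f z + C.meanSqDist f w) / 2 - dist z w ^ 2 / 4 =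
      ∑ u, C.ν u * ((dist (f u) z ^ 2 + dist (f u) w ^ 2) / 2 - dist z w ^ 2 / 4) := by
    have e : ∀ u, C.ν u * ((dist (f u) z ^ 2 + dist (f u) w ^ 2) / 2 - dist z w ^ 2 / 4) =
        (1 / 2) * (C.ν u * dist (f u) z ^ 2) + (1 / 2) * (C.ν u * dist (f u) w ^ 2) -
          C.ν u * (dist z w ^ 2 / 4) := fun u => by ring
    simp only [e, Finset.sum_sub_distrib, Finset.sum_add_distrib, ← Finset.mul_sum,
      ← Finset.sum_mul, C.ν_sum, ReversibleChain.meanSqDist]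
    ring
  rw [h]
  exact Finset.sum_le_sum fun u _ => mul_le_mul_of_nonneg_left (hm (f u)) (C.ν_nonneg u)

theorem ReversibleChain.continuous_meanSqDist (f : V → Y) : Continuous (C.meanSqDist f) := by
  unfold ReversibleChain.meanSqDist
  fun_prop

/-- In a complete CAT(0) space the mean square distance attains its minimum. -/
theorem IsCAT0.exists_barycenter [CompleteSpace Y] [Nonempty Y] (hY : IsCAT0 Y) (f : V → Y) :
    ∃ y, ∀ z, C.meanSqDist f y ≤ C.meanSqDist f z := by
  have hbdd : BddBelow (Set.range (C.meanSqDist f)) :=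
    ⟨0, Set.forall_mem_range.mpr fun z =>
      Finset.sum_nonneg fun u _ => mul_nonneg (C.ν_nonneg u) (sq_nonneg _)⟩
  set I := ⨅ z, C.meanSqDist f z with hI
  have hIle : ∀ z, I ≤ C.meanSqDist f z := fun z => ciInf_le hbdd z
  have hex : ∀ n : ℕ, ∃ z, C.meanSqDist f z < I + 1 / ((n : ℝ) + 1) := fun n =>
    exists_lt_of_ciInf_lt (lt_add_of_pos_right I (by positivity))
  choose z hz using hex
  have hlim : Filter.Tendsto (fun n : ℕ => 1 / ((n : ℝ) + 1)) Filter.atTop (𝓝 0) :=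
    tendsto_one_div_add_atTop_nhds_zero_nat
  have hcauchy : CauchySeq z := by
    refine cauchySeq_of_le_tendsto_0 (fun n : ℕ => √(4 * (1 / ((n : ℝ) + 1)))) ?_ ?_
    · intro n m k hn hm
      -- The value at the midpoint is at least `I`, which forces `dist (z n) (z m) ^ 2 / 4 ≤ 1 / (k
      -- + 1)`.
      obtain ⟨w, hw⟩ := hY.exists_meanSqDist_midpoint C f (z n) (z m)
      apply Real.le_sqrt_of_sq_le
      have h1 : 1 / ((n : ℝ) + 1) ≤ 1 / ((k : ℝ) + 1) :=
        one_div_le_one_div_of_le (by positivity) (by gcongr)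
      have h2 : 1 / ((m : ℝ) + 1) ≤ 1 / ((k : ℝ) + 1) :=
        one_div_le_one_div_of_le (by positivity) (by gcongr)
      linarith [hz n, hz m, hIle w]
    · have := (hlim.const_mul 4).sqrt
      simpa using this
  obtain ⟨y, hy⟩ := cauchySeq_tendsto_of_complete hcauchy
  refine ⟨y, fun w => le_trans ?_ (hIle w)⟩
  have h1 := ((C.continuous_meanSqDist f).tendsto y).comp hy
  have h2 : Filter.Tendsto (fun n : ℕ => I + 1 / ((n : ℝ) + 1)) Filter.atTop (𝓝 I) := by
    simpa using hlim.const_add I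
  exact le_of_tendsto_of_tendsto' h1 h2 fun n => (hz n).le

end Barycenter

/-! ### The logarithm map and the first variation -/

/-- A geodesic segment from `y` to `p ≠ y` in a CAT(0) space. -/
def IsCAT0.segment (hY : IsCAT0 Y) (y p : Y) (h : y ≠ p) : GeodesicFrom y where
  toFun := (hY.geodesic y p).choose
  length := dist y p
  length_pos := dist_pos.mpr h
  start := (hY.geodesic y p).choose_spec.left
  isGeodesicOn := (hY.geodesic y p).choose_spec.isGeodesicOn

theorem IsCAT0.segment_dist (hY : IsCAT0 Y) (y p : Y) (h : y ≠ p) :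
    (hY.segment y p h).toFun (dist y p) = p :=
  (hY.geodesic y p).choose_spec.right

open Classical in
/-- The logarithm map of a CAT(0) space to its tangent cone at `y`. -/
def IsCAT0.log (hY : IsCAT0 Y) (y p : Y) : TangentCone y :=
  if h : y = p then InfiniteCone.apex
  else InfiniteCone.point (dist y p) (dist_pos.mpr h) (SeparationQuotient.mk (hY.segment y p h))

theorem TangentCone.dist_point {y : Y} {a b : ℝ} (ha : 0 < a) (hb : 0 < b)
    (γ γ' : GeodesicFrom y) :
    dist (InfiniteCone.point a ha (SeparationQuotient.mk γ) : TangentCone y)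
      (InfiniteCone.point b hb (SeparationQuotient.mk γ')) =
      sideLength a b (alexandroffAngle γ γ') := by
  change sideLength a b (min (dist (SeparationQuotient.mk γ) (SeparationQuotient.mk γ'))
    Real.pi) = _
  rw [SeparationQuotient.dist_mk]
  change sideLength a b (min (alexandroffAngle γ γ') Real.pi) = _
  rw [min_eq_left (alexandroffAngle_le_pi γ γ')]

theorem InfiniteCone.dist_apex_left {S : Type u} [MetricSpace S] (x : InfiniteCone S) :
    dist apex x = radius x := by
  change sideLength 0 (radius x) _ = _
  rw [sideLength]
  simp [Real.sqrt_sq (radius_nonneg x)]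

theorem InfiniteCone.dist_apex_right {S : Type u} [MetricSpace S] (x : InfiniteCone S) :
    dist x apex = radius x := by
  rw [dist_comm, dist_apex_left]

theorem IsCAT0.radius_log (hY : IsCAT0 Y) (y p : Y) :
    InfiniteCone.radius (hY.log y p) = dist y p := by
  unfold IsCAT0.log
  split_ifs with h
  · rw [h, dist_self]; rfl
  · rfl

/-- Radii are preserved, while the comparison angle is replaced by the smaller Alexandroff angle;
the side opposite to it shrinks. -/
theorem IsCAT0.dist_log_le (hY : IsCAT0 Y) (y p q : Y) :
    dist (hY.log y p) (hY.log y q) ≤ dist p q := by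
  by_cases hp : y = p
  · have : hY.log y p = InfiniteCone.apex := dif_pos hp
    rw [this, InfiniteCone.dist_apex_left, hY.radius_log, hp]
  by_cases hq : y = q
  · have : hY.log y q = InfiniteCone.apex := dif_pos hq
    rw [this, InfiniteCone.dist_apex_right, hY.radius_log, hq, dist_comm]
  have e1 : hY.log y p = InfiniteCone.point (dist y p) (dist_pos.mpr hp)
    (SeparationQuotient.mk (hY.segment y p hp)) := dif_neg hp
  have e2 : hY.log y q = InfiniteCone.point (dist y q) (dist_pos.mpr hq)
    (SeparationQuotient.mk (hY.segment y q hq)) := dif_neg hq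
  rw [e1, e2, TangentCone.dist_point]
  have h := hY.alexandroffAngle_le (hY.segment y p hp) (hY.segment y q hq) (dist_pos.mpr hp)
    le_rfl (dist_pos.mpr hq) le_rfl
  rw [hY.segment_dist, hY.segment_dist] at h
  calc _ ≤ sideLength (dist y p) (dist y q) (comparisonAngle y p q) :=
        sideLength_mono dist_nonneg dist_nonneg (alexandroffAngle_nonneg _ _)
          (comparisonAngle_le_pi _ _) h
    _ = _ := sideLength_comparisonAngle _ _ _

/-- The first variation inequality. -/
theorem IsCAT0.eventually_sq_dist_le (hY : IsCAT0 Y) {y p : Y} (h : y ≠ p) (γ : GeodesicFrom y)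
    {c : ℝ} (hc : c < Real.cos (alexandroffAngle (hY.segment y p h) γ)) :
    ∃ K : ℝ, ∀ᶠ t in 𝓝[>] (0 : ℝ),
      dist p (γ.toFun t) ^ 2 ≤ dist y p ^ 2 - 2 * t * (dist y p * c) + K * t ^ 2 := by
  set L := dist y p with hL
  have hL0 : 0 < L := dist_pos.mpr h
  set β := hY.segment y p h with hβ
  have h1 := ((Real.continuous_cos.tendsto _).comp
    (hY.tendsto_comparisonAngle β γ)).eventually (lt_mem_nhds hc)
  -- First `s` is fixed, then `t` tends to `0`. The path from `p` to `γ t` is estimated by a detour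
  -- through `β s`, and `K = L / s` collects the terms in `t ^ 2`.
  obtain ⟨s, hs, hs0, hsL⟩ := (h1.curry.and (eventually_small hL0)).exists
  refine ⟨L / s, ?_⟩
  filter_upwards [hs, eventually_small γ.length_pos] with t ht ht'
  have d1 : dist y (β.toFun s) = s := β.dist_start hs0.le hsL.le
  have d2 : dist y (γ.toFun t) = t := γ.dist_start ht'.1.le ht'.2.le
  have hD := cos_comparisonAngle y (β.toFun s) (γ.toFun t)
  rw [d1, d2] at hD
  set D := dist (β.toFun s) (γ.toFun t) with hDdef
  have hD0 : 0 ≤ D := dist_nonneg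
  have hD2 : D ^ 2 ≤ s ^ 2 + t ^ 2 - 2 * s * t * c := by
    have : 2 * s * t * c ≤ 2 * s * t * Real.cos (comparisonAngle y (β.toFun s) (γ.toFun t)) :=
      mul_le_mul_of_nonneg_left (le_of_lt ht) (by have := ht'.1; positivity)
    linarith
  have hps : dist p (β.toFun s) = L - s := by
    have : p = β.toFun L := (hY.segment_dist y p h).symm
    conv_lhs => rw [this]
    rw [β.isGeodesicOn L ⟨hL0.le, le_rfl⟩ s ⟨hs0.le, hsL.le⟩, abs_of_pos (by linarith)]
  have htri : dist p (γ.toFun t) ≤ (L - s) + D := by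
    rw [← hps]; exact dist_triangle _ _ _
  have h3 : dist p (γ.toFun t) ^ 2 ≤ ((L - s) + D) ^ 2 :=
    pow_le_pow_left₀ dist_nonneg htri 2
  -- The square root is linearised at `s ^ 2` by `2 * s * D ≤ s ^ 2 + D ^ 2`.
  have h4 : D ≤ s + t ^ 2 / (2 * s) - t * c := by
    have : s * D ≤ s * (s + t ^ 2 / (2 * s) - t * c) := by
      have e : s * (s + t ^ 2 / (2 * s) - t * c) = s ^ 2 + t ^ 2 / 2 - s * t * c := by
        field_simp
      rw [e]
      nlinarith [sq_nonneg (D - s)]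
    exact le_of_mul_le_mul_left this hs0
  have h5 : 2 * (L - s) * D ≤ 2 * (L - s) * (s + t ^ 2 / (2 * s) - t * c) :=
    mul_le_mul_of_nonneg_left h4 (by linarith)
  have e : (L - s) ^ 2 + 2 * (L - s) * (s + t ^ 2 / (2 * s) - t * c) +
      (s ^ 2 + t ^ 2 - 2 * s * t * c) = L ^ 2 - 2 * t * (L * c) + L / s * t ^ 2 := by
    field_simp
    ring
  linarith [add_sq (L - s) D]

theorem InfiniteCone.sq_dist_eq {S : Type u} [MetricSpace S] (x x' : InfiniteCone S) :
    dist x x' ^ 2 = radius x ^ 2 + radius x' ^ 2 -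
      2 * radius x * radius x' * Real.cos (angle x x') :=
  sq_sideLength _ _ _

section Variation

variable {V : Type} [Fintype V] [DecidableEq V] (C : ReversibleChain V)

/-- The logarithm at a barycenter has nonpositive mean inner product with every direction. -/
theorem IsCAT0.sum_cos_angle_log_nonpos (hY : IsCAT0 Y) {f : V → Y} {y : Y}
    (hy : ∀ z, C.meanSqDist f y ≤ C.meanSqDist f z) (q : Y) (hq : y ≠ q) :
    ∑ u, C.ν u * (dist y (f u) *
      Real.cos (InfiniteCone.angle (hY.log y (f u)) (hY.log y q))) ≤ 0 := by
  set γ := hY.segment y q hq with hγ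
  set k : V → ℝ := fun u => Real.cos (InfiniteCone.angle (hY.log y (f u)) (hY.log y q)) with hk
  -- The first variation inequality needs a number strictly below the cosine; `ε` is removed at the
  -- end.
  have key : ∀ ε > 0, ∑ u, C.ν u * (dist y (f u) * (k u - ε)) ≤ 0 := by
    intro ε hε
    have hex : ∀ u, ∃ K : ℝ, ∀ᶠ t in 𝓝[>] (0 : ℝ), dist (f u) (γ.toFun t) ^ 2 ≤
        dist y (f u) ^ 2 - 2 * t * (dist y (f u) * (k u - ε)) + K * t ^ 2 := by
      intro u
      by_cases hu : y = f u
      · refine ⟨1, ?_⟩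
        filter_upwards [eventually_small γ.length_pos] with t ht
        rw [← hu, dist_self, γ.dist_start ht.1.le ht.2.le]
        linarith
      · refine hY.eventually_sq_dist_le hu γ ?_
        have e1 : hY.log y (f u) = InfiniteCone.point (dist y (f u)) (dist_pos.mpr hu)
          (SeparationQuotient.mk (hY.segment y (f u) hu)) := dif_neg hu
        have e2 : hY.log y q = InfiniteCone.point (dist y q) (dist_pos.mpr hq)
          (SeparationQuotient.mk γ) := dif_neg hq
        have e3 : k u = Real.cos (alexandroffAngle (hY.segment y (f u) hu) γ) := by
          simp only [hk]
          rw [e1, e2]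
          change Real.cos (min (dist (SeparationQuotient.mk _) (SeparationQuotient.mk _)) _) = _
          rw [SeparationQuotient.dist_mk]
          exact congrArg Real.cos (min_eq_left (alexandroffAngle_le_pi _ _))
        linarith
    choose K hK using hex
    set S := ∑ u, C.ν u * (dist y (f u) * (k u - ε)) with hS
    -- Moving from `y` along `γ` cannot lower the mean square distance; the resulting inequality is
    -- divided by `t`.
    have hev : ∀ᶠ t in 𝓝[>] (0 : ℝ), 2 * S ≤ (∑ u, C.ν u * K u) * t := by
      filter_upwards [Filter.eventually_all.mpr hK, self_mem_nhdsWithin] with t ht ht0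
      have h1 : C.meanSqDist f (γ.toFun t) ≤
          C.meanSqDist f y - 2 * t * S + (∑ u, C.ν u * K u) * t ^ 2 := by
        rw [hS, ReversibleChain.meanSqDist, ReversibleChain.meanSqDist, Finset.mul_sum,
          Finset.sum_mul, ← Finset.sum_sub_distrib, ← Finset.sum_add_distrib]
        refine Finset.sum_le_sum fun u _ => ?_
        have := mul_le_mul_of_nonneg_left (ht u) (C.ν_nonneg u)
        rw [dist_comm (f u) y]
        linarith
      have h2 := hy (γ.toFun t)
      have ht0 : 0 < t := ht0
      have h3 : t * (2 * S) ≤ t * ((∑ u, C.ν u * K u) * t) := by nlinarith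
      exact le_of_mul_le_mul_left h3 ht0
    have hlim : Filter.Tendsto (fun t : ℝ => (∑ u, C.ν u * K u) * t) (𝓝[>] 0) (𝓝 0) := by
      have : Filter.Tendsto (fun t : ℝ => (∑ u, C.ν u * K u) * t) (𝓝 0)
          (𝓝 ((∑ u, C.ν u * K u) * 0)) := (continuous_const.mul continuous_id).tendsto 0
      rw [mul_zero] at this
      exact this.mono_left nhdsWithin_le_nhds
    have := ge_of_tendsto hlim hev
    linarith
  have hlim : Filter.Tendsto (fun ε : ℝ => ∑ u, C.ν u * (dist y (f u) * (k u - ε))) (𝓝[>] 0)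
      (𝓝 (∑ u, C.ν u * (dist y (f u) * (k u - 0)))) := by
    have : Continuous fun ε : ℝ => ∑ u, C.ν u * (dist y (f u) * (k u - ε)) := by fun_prop
    exact (this.tendsto 0).mono_left nhdsWithin_le_nhds
  simp only [sub_zero] at hlim
  exact le_of_tendsto hlim (by filter_upwards [self_mem_nhdsWithin] with ε hε using key ε hε)

/-- The triangle inequality through `y` and `(a + b) ^ 2 ≤ 2 * a ^ 2 + 2 * b ^ 2`, summed over both
variables. -/
theorem ReversibleChain.spread_le_meanSqDist (f : V → Y) (y : Y) :
    C.spread f ≤ 4 * C.meanSqDist f y := by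
  have h : ∀ u v, C.ν u * C.ν v * dist (f u) (f v) ^ 2 ≤
      2 * (C.ν v * (C.ν u * dist (f u) y ^ 2)) + 2 * (C.ν u * (C.ν v * dist (f v) y ^ 2)) := by
    intro u v
    have h1 := dist_triangle_right (f u) (f v) y
    have h2 := pow_le_pow_left₀ dist_nonneg h1 2
    have h3 : dist (f u) (f v) ^ 2 ≤ 2 * dist (f u) y ^ 2 + 2 * dist (f v) y ^ 2 := by
      nlinarith [sq_nonneg (dist (f u) y - dist (f v) y)]
    have := mul_le_mul_of_nonneg_left h3 (mul_nonneg (C.ν_nonneg u) (C.ν_nonneg v))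
    linarith
  refine (Finset.sum_le_sum fun u _ => Finset.sum_le_sum fun v _ => h u v).trans_eq ?_
  simp only [Finset.sum_add_distrib, ← Finset.mul_sum, ← Finset.sum_mul, C.ν_sum,
    ReversibleChain.meanSqDist]
  ring

/-- The law of cosines in the cone gives twice the mean square distance minus a cross term. For each
fixed `v`, the cross term is nonpositive by the variation inequality towards `f v`; in a Hilbert
space it would vanish. -/
theorem IsCAT0.meanSqDist_le_spread_log (hY : IsCAT0 Y) {f : V → Y} {y : Y}
    (hy : ∀ z, C.meanSqDist f y ≤ C.meanSqDist f z) :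
    2 * C.meanSqDist f y ≤ C.spread fun u => hY.log y (f u) := by
  have e : ∀ u v, C.ν u * C.ν v * dist (hY.log y (f u)) (hY.log y (f v)) ^ 2 =
      C.ν v * (C.ν u * dist (f u) y ^ 2) + C.ν u * (C.ν v * dist (f v) y ^ 2) -
        2 * (C.ν v * dist y (f v) * (C.ν u * (dist y (f u) *
          Real.cos (InfiniteCone.angle (hY.log y (f u)) (hY.log y (f v)))))) := by
    intro u v
    rw [InfiniteCone.sq_dist_eq, hY.radius_log, hY.radius_log, dist_comm (f u), dist_comm (f v)]
    ring
  have h : ∑ u, ∑ v, C.ν v * dist y (f v) * (C.ν u * (dist y (f u) *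
      Real.cos (InfiniteCone.angle (hY.log y (f u)) (hY.log y (f v))))) ≤ 0 := by
    rw [Finset.sum_comm]
    refine Finset.sum_nonpos fun v _ => ?_
    rw [← Finset.mul_sum]
    by_cases hv : y = f v
    · rw [← hv, dist_self, mul_zero, zero_mul]
    · exact mul_nonpos_of_nonneg_of_nonpos (mul_nonneg (C.ν_nonneg v) dist_nonneg)
        (hY.sum_cos_angle_log_nonpos C hy (f v) hv)
  simp only [ReversibleChain.spread, e, Finset.sum_sub_distrib, Finset.sum_add_distrib,
    ← Finset.mul_sum] at h ⊢
  simp only [← Finset.sum_mul, C.ν_sum, one_mul, ReversibleChain.meanSqDist] at h ⊢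
  linarith

theorem IsCAT0.energy_log_le (hY : IsCAT0 Y) (f : V → Y) (y : Y) :
    (C.energy fun u => hY.log y (f u)) ≤ C.energy f :=
  Finset.sum_le_sum fun u _ => Finset.sum_le_sum fun v _ =>
    mul_le_mul_of_nonneg_left (pow_le_pow_left₀ dist_nonneg (hY.dist_log_le _ _ _) 2)
      (mul_nonneg (C.ν_nonneg u) (C.P_nonneg u v))

/-- A chain that satisfies a Poincaré inequality for the logarithm of `f` at the barycenter
satisfies one for `f`. -/
theorem IsCAT0.exists_log [CompleteSpace Y] (hY : IsCAT0 Y) (f : V → Y) :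
    ∃ y, ∀ L : ℝ≥0∞, ENNReal.ofReal (C.spread fun u => hY.log y (f u)) ≤
        L ^ 2 * ENNReal.ofReal (C.energy fun u => hY.log y (f u)) →
      ENNReal.ofReal (C.spread f) ≤ (2 * L) ^ 2 * ENNReal.ofReal (C.energy f) := by
  have hV : Nonempty V := by
    by_contra h
    rw [not_nonempty_iff] at h
    simpa using C.ν_sum
  have : Nonempty Y := hV.map f
  obtain ⟨y, hy⟩ := hY.exists_barycenter C f
  refine ⟨y, fun L hL => ?_⟩
  have h1 := C.spread_le_meanSqDist f y
  have h2 := hY.meanSqDist_le_spread_log C hy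
  have h0 := C.spread_nonneg fun u => hY.log y (f u)
  -- `h1` and `h2` even bound the spread of `f` by twice that of its logarithm; the weaker factor
  -- `4` is the square of the `2` in the conclusion.
  calc ENNReal.ofReal (C.spread f)
      ≤ ENNReal.ofReal (4 * C.spread fun u => hY.log y (f u)) :=
        ENNReal.ofReal_le_ofReal (by linarith)
    _ = 4 * ENNReal.ofReal (C.spread fun u => hY.log y (f u)) := by
        rw [ENNReal.ofReal_mul (by norm_num)]; norm_num
    _ ≤ 4 * (L ^ 2 * ENNReal.ofReal (C.energy f)) := by
        refine mul_le_mul_right (hL.trans (mul_le_mul_right ?_ _)) _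
        exact ENNReal.ofReal_le_ofReal (hY.energy_log_le C f y)
    _ = (2 * L) ^ 2 * ENNReal.ofReal (C.energy f) := by rw [mul_pow]; ring

end Variation

/-! ### Comparison of the moduli of a space and its tangent cones -/

theorem le_two_mul_of_forall_gt {x S : ℝ≥0∞} (h : ∀ L, S < L → x ≤ 2 * L) : x ≤ 2 * S := by
  rw [mul_comm, ← ENNReal.div_le_iff_le_mul (.inl two_ne_zero) (.inl ENNReal.ofNat_ne_top)]
  refine le_of_forall_gt_imp_ge_of_dense fun L hL => ?_
  rw [ENNReal.div_le_iff_le_mul (.inl two_ne_zero) (.inl ENNReal.ofNat_ne_top), mul_comm]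
  exact h L hL

theorem IsCAT0.poincareModulus_le [CompleteSpace Y] (hY : IsCAT0 Y) (σ : ℝ) :
    poincareModulus 2 Y σ ≤ 2 * ⨆ y : Y, poincareModulus 2 (TangentCone y) σ := by
  refine le_two_mul_of_forall_gt fun L hL => poincareModulus_two_le fun V _ _ C hgap f => ?_
  obtain ⟨y, hy⟩ := hY.exists_log C f
  exact hy L (ofReal_spread_le_of_poincareModulus_lt
    ((le_iSup (fun y : Y => poincareModulus 2 (TangentCone y) σ) y).trans_lt hL) C hgap _)

theorem IsCAT0.localPoincareModulus_le [CompleteSpace Y] (hY : IsCAT0 Y) (σ : ℝ) (N : ℕ) :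
    localPoincareModulus 2 Y σ N ≤ 2 * ⨆ y : Y, localPoincareModulus 2 (TangentCone y) σ N := by
  refine le_two_mul_of_forall_gt fun L hL => iSup₂_le fun Y' hY' =>
    poincareModulus_two_le fun V _ _ C hgap f => ?_
  obtain ⟨y, hy⟩ := hY.exists_log C fun u => (f u : Y)
  refine hy L ?_
  -- The barycenter may lie outside `Y'`; only the number of values of the logarithm matters.
  have h1 : poincareModulus 2 (hY.log y '' Y') σ ≤ localPoincareModulus 2 (TangentCone y) σ N :=
    le_iSup₂_of_le (f := fun (Z : Set (TangentCone y)) (_ : Z.encard ≤ N) =>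
      poincareModulus 2 Z σ) _ ((Set.encard_image_le _ _).trans hY') le_rfl
  have h2 := h1.trans
    (le_iSup (fun y : Y => localPoincareModulus 2 (TangentCone y) σ N) y)
  exact ofReal_spread_le_of_poincareModulus_lt (h2.trans_lt hL) C hgap
    fun u => (⟨hY.log y (f u), Set.mem_image_of_mem _ (f u).2⟩ : hY.log y '' Y')

end CAT0

section TangentCone

/-! ### Tangent cones as blow-ups -/

variable {Y : Type u} [MetricSpace Y]

/-- The curve `t ↦ γ (a t)` in the direction of the point `aγ` of the tangent cone. -/
def TangentCone.ray {y : Y} : TangentCone y → ℝ → Y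
  | InfiniteCone.apex => fun _ => y
  | InfiniteCone.point a _ ξ => fun t =>
    (SeparationQuotient.surjective_mk ξ).choose.toFun (a * t)

theorem tendsto_const_mul_nhdsGT_zero {a : ℝ} (ha : 0 < a) :
    Filter.Tendsto (fun t => a * t) (𝓝[>] (0 : ℝ)) (𝓝[>] 0) := by
  refine tendsto_nhdsWithin_iff.mpr ⟨?_, ?_⟩
  · have : Filter.Tendsto (fun t : ℝ => a * t) (𝓝 0) (𝓝 (a * 0)) :=
      (continuous_const.mul continuous_id).tendsto 0
    rw [mul_zero] at this
    exact this.mono_left nhdsWithin_le_nhds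
  · filter_upwards [self_mem_nhdsWithin] with t ht using mul_pos ha ht

theorem TangentCone.dist_start_ray {y : Y} (x : TangentCone y) :
    ∀ᶠ t in 𝓝[>] (0 : ℝ), dist y (x.ray t) = t * x.radius := by
  rcases x with _ | ⟨a, ha, ξ⟩
  · simp [TangentCone.ray, InfiniteCone.radius]
  · filter_upwards [tendsto_const_mul_nhdsGT_zero ha (eventually_small
      (SeparationQuotient.surjective_mk ξ).choose.length_pos)] with t ht
    simp only [TangentCone.ray, InfiniteCone.radius]
    rw [GeodesicFrom.dist_start _ ht.1.le ht.2.le, mul_comm]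

theorem TangentCone.tendsto_ray {y : Y} (x : TangentCone y) :
    Filter.Tendsto x.ray (𝓝[>] 0) (𝓝 y) := by
  rw [tendsto_iff_dist_tendsto_zero]
  have h : Filter.Tendsto (fun t : ℝ => t * x.radius) (𝓝[>] 0) (𝓝 0) := by
    have : Filter.Tendsto (fun t : ℝ => t * x.radius) (𝓝 0) (𝓝 (0 * x.radius)) :=
      (continuous_id.mul continuous_const).tendsto 0
    rw [zero_mul] at this
    exact this.mono_left nhdsWithin_le_nhds
  refine h.congr' ?_
  filter_upwards [x.dist_start_ray] with t ht
  rw [dist_comm, ht]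

/-- In a CAT(0) space the metric of the tangent cone is the limit of the rescaled metrics. -/
theorem IsCAT0.tendsto_dist_ray (hY : IsCAT0 Y) {y : Y} (x x' : TangentCone y) :
    Filter.Tendsto (fun t => dist (x.ray t) (x'.ray t) / t) (𝓝[>] 0) (𝓝 (dist x x')) := by
  have apex : ∀ x : TangentCone y,
      Filter.Tendsto (fun t => dist y (x.ray t) / t) (𝓝[>] 0) (𝓝 x.radius) := by
    intro x
    refine (tendsto_const_nhds (x := x.radius)).congr' ?_
    filter_upwards [x.dist_start_ray, self_mem_nhdsWithin] with t ht ht0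
    rw [ht, mul_div_cancel_left₀ _ (ne_of_gt ht0)]
  rcases x with _ | ⟨a, ha, ξ⟩
  · rw [InfiniteCone.dist_apex_left]
    exact apex x'
  rcases x' with _ | ⟨b, hb, η⟩
  · rw [InfiniteCone.dist_apex_right]
    simp_rw [dist_comm _ (TangentCone.ray InfiniteCone.apex _)]
    exact apex _
  set γ := (SeparationQuotient.surjective_mk ξ).choose with hγ
  set γ' := (SeparationQuotient.surjective_mk η).choose with hγ'
  have e1 : SeparationQuotient.mk γ = ξ := (SeparationQuotient.surjective_mk ξ).choose_spec
  have e2 : SeparationQuotient.mk γ' = η := (SeparationQuotient.surjective_mk η).choose_spec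
  have hd : dist (InfiniteCone.point a ha ξ : TangentCone y) (InfiniteCone.point b hb η) =
      sideLength a b (alexandroffAngle γ γ') := by
    rw [← TangentCone.dist_point ha hb, e1, e2]
  rw [hd]
  have ta := tendsto_const_mul_nhdsGT_zero ha
  have tb := tendsto_const_mul_nhdsGT_zero hb
  -- By the law of cosines and homogeneity, the rescaled distance is `sideLength a b` of the
  -- comparison angle at `(a * t, b * t)`.
  have hlim := ((continuous_sideLength a b).tendsto _).comp
    ((hY.tendsto_comparisonAngle γ γ').comp (ta.prodMk tb))
  refine hlim.congr' ?_
  filter_upwards [ta (eventually_small γ.length_pos), tb (eventually_small γ'.length_pos),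
    self_mem_nhdsWithin] with t hta htb ht0
  have ht0 : 0 < t := ht0
  have h := sideLength_comparisonAngle y (γ.toFun (a * t)) (γ'.toFun (b * t))
  rw [γ.dist_start hta.1.le hta.2.le, γ'.dist_start htb.1.le htb.2.le,
    sideLength_mul ht0.le] at h
  change _ = dist (γ.toFun (a * t)) (γ'.toFun (b * t)) / t
  rw [← h, mul_div_cancel_left₀ _ ht0.ne']
  rfl

/-- If a CAT(0) space is infinitesimally Euclidean at `y`, then its tangent cone at `y` satisfies
the Poincaré inequality of Euclidean spaces. -/
theorem IsCAT0.poincareModulus_tangentCone_le (hY : IsCAT0 Y) {y : Y} {F : Type*}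
    [NormedAddCommGroup F] [InnerProductSpace ℝ F] (Φ : Y → F)
    (hΦ : ∀ r > 1, ∀ᶠ q : Y × Y in 𝓝 (y, y),
      dist q.1 q.2 ≤ r * dist (Φ q.1) (Φ q.2) ∧ dist (Φ q.1) (Φ q.2) ≤ r * dist q.1 q.2)
    {σ : ℝ} (hσ : 0 < σ) :
    poincareModulus 2 (TangentCone y) σ ≤ ENNReal.ofReal (1 / √σ) := by
  refine poincareModulus_two_le fun V _ _ C hgap g => ?_
  have hblow : ∀ m : V → V → ℝ, Filter.Tendsto
      (fun t => ∑ u, ∑ v, m u v * (dist ((g u).ray t) ((g v).ray t) / t) ^ 2) (𝓝[>] 0)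
      (𝓝 (∑ u, ∑ v, m u v * dist (g u) (g v) ^ 2)) := fun m =>
    tendsto_finsetSum _ fun u _ => tendsto_finsetSum _ fun v _ =>
      ((hY.tendsto_dist_ray (g u) (g v)).pow 2).const_mul _
  -- The inequality in `F` is applied to `Φ` along the rays at scale `t`. Each passage between `Y`
  -- and `F` costs `r ^ 2`, one in the spread and one in the energy.
  have key : ∀ r > 1, σ * C.spread g ≤ r ^ 4 * C.energy g := by
    intro r hr
    refine le_of_tendsto_of_tendsto ((hblow fun u v => C.ν u * C.ν v).const_mul σ)
      ((hblow fun u v => C.ν u * C.P u v).const_mul (r ^ 4)) ?_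
    have hev : ∀ᶠ t in 𝓝[>] (0 : ℝ), ∀ u v,
        dist ((g u).ray t) ((g v).ray t) ≤ r * dist (Φ ((g u).ray t)) (Φ ((g v).ray t)) ∧
        dist (Φ ((g u).ray t)) (Φ ((g v).ray t)) ≤ r * dist ((g u).ray t) ((g v).ray t) := by
      refine Filter.eventually_all.mpr fun u => Filter.eventually_all.mpr fun v => ?_
      exact ((g u).tendsto_ray.prodMk_nhds (g v).tendsto_ray).eventually (hΦ r hr)
    filter_upwards [hev] with t ht
    have h1 := C.mul_spread_le_energy hgap fun u => Φ ((g u).ray t)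
    have h2 : ∑ u, ∑ v, C.ν u * C.ν v * (dist ((g u).ray t) ((g v).ray t) / t) ^ 2 ≤
        r ^ 2 * (t⁻¹ ^ 2 * C.spread fun u => Φ ((g u).ray t)) := by
      simp only [ReversibleChain.spread, Finset.mul_sum]
      refine Finset.sum_le_sum fun u _ => Finset.sum_le_sum fun v _ => ?_
      have h3 := pow_le_pow_left₀ dist_nonneg (ht u v).1 2
      have h4 := mul_le_mul_of_nonneg_left h3
        (mul_nonneg (mul_nonneg (C.ν_nonneg u) (C.ν_nonneg v)) (sq_nonneg t⁻¹))
      rw [div_eq_mul_inv]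
      linarith
    have h3 : (t⁻¹ ^ 2 * C.energy fun u => Φ ((g u).ray t)) ≤
        r ^ 2 * ∑ u, ∑ v, C.ν u * C.P u v * (dist ((g u).ray t) ((g v).ray t) / t) ^ 2 := by
      simp only [ReversibleChain.energy, Finset.mul_sum]
      refine Finset.sum_le_sum fun u _ => Finset.sum_le_sum fun v _ => ?_
      have h3 := pow_le_pow_left₀ dist_nonneg (ht u v).2 2
      have h4 := mul_le_mul_of_nonneg_left h3
        (mul_nonneg (mul_nonneg (C.ν_nonneg u) (C.P_nonneg u v)) (sq_nonneg t⁻¹))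
      rw [div_eq_mul_inv]
      linarith
    have h5 := mul_le_mul_of_nonneg_left h1 (mul_nonneg (sq_nonneg r) (sq_nonneg t⁻¹))
    have h6 := mul_le_mul_of_nonneg_left h2 hσ.le
    have h7 := mul_le_mul_of_nonneg_left h3 (sq_nonneg r)
    change σ * _ ≤ r ^ 4 * _
    linarith
  have hfin : σ * C.spread g ≤ C.energy g := by
    have hlim : Filter.Tendsto (fun r : ℝ => r ^ 4 * C.energy g) (𝓝[>] 1)
        (𝓝 (1 ^ 4 * C.energy g)) := by
      have : Continuous fun r : ℝ => r ^ 4 * C.energy g := by fun_prop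
      exact (this.tendsto 1).mono_left nhdsWithin_le_nhds
    rw [one_pow, one_mul] at hlim
    exact ge_of_tendsto hlim (by filter_upwards [self_mem_nhdsWithin] with r hr using key r hr)
  rw [← ENNReal.ofReal_pow (by positivity), ← ENNReal.ofReal_mul (by positivity)]
  apply ENNReal.ofReal_le_ofReal
  rw [div_pow, Real.sq_sqrt hσ.le, one_pow, one_div, ← div_eq_inv_mul, le_div_iff₀ hσ]
  linarith

end TangentCone

section Riemannian

/-! ### Riemannian manifolds are infinitesimally Euclidean -/

variable {E : Type*} [NormedAddCommGroup E] [InnerProductSpace ℝ E]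
  {M : Type*} [MetricSpace M] [ChartedSpace E M] [IsManifold 𝓘(ℝ, E) ∞ M]
  [Bundle.RiemannianBundle (fun x : M => TangentSpace 𝓘(ℝ, E) x)]

/-- The image in a linearised chart of a path that stays in a region where this chart expands
tangent vectors at most by the factor `c`. -/
theorem enorm_sub_chart_le_pathELength {F : Type*} [NormedAddCommGroup F] [NormedSpace ℝ F]
    (x : M) (S : E →L[ℝ] F) (c : ℝ≥0∞) (hc : c ≠ ⊤) {γ : ℝ → M}
    (hγ : ContMDiff 𝓘(ℝ, ℝ) 𝓘(ℝ, E) 1 γ)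
    (hs : ∀ t ∈ Set.Icc (0 : ℝ) 1, γ t ∈ (chartAt E x).source)
    (hS : ∀ t ∈ Set.Icc (0 : ℝ) 1, ∀ v : TangentSpace 𝓘(ℝ, E) (γ t),
      ‖S (mfderiv 𝓘(ℝ, E) 𝓘(ℝ, E) (extChartAt 𝓘(ℝ, E) x) (γ t) v)‖ₑ ≤ c * ‖v‖ₑ) :
    ‖S (extChartAt 𝓘(ℝ, E) x (γ 1)) - S (extChartAt 𝓘(ℝ, E) x (γ 0))‖ₑ ≤
      c * Manifold.pathELength 𝓘(ℝ, E) γ 0 1 := by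
  set φ : M → E := ⇑(extChartAt 𝓘(ℝ, E) x) with hφ
  have hC : ContDiffOn ℝ 1 (φ ∘ γ) (Set.Icc 0 1) := by
    rw [← contMDiffOn_iff_contDiffOn]
    exact (contMDiffOn_extChartAt (n := 1)).comp (t := (chartAt E x).source) hγ.contMDiffOn hs
  have hderiv : ∀ t ∈ Set.Icc (0 : ℝ) 1, derivWithin (fun s => S (φ (γ s))) (Set.Icc 0 1) t =
      S (mfderiv 𝓘(ℝ, E) 𝓘(ℝ, E) φ (γ t)
        (mfderivWithin 𝓘(ℝ, ℝ) 𝓘(ℝ, E) γ (Set.Icc 0 1) t (1 : ℝ))) := by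
    intro t ht
    have huniq := uniqueDiffOn_Icc (zero_lt_one' ℝ) t ht
    have h1 : HasDerivWithinAt (φ ∘ γ) (derivWithin (φ ∘ γ) (Set.Icc 0 1) t) (Set.Icc 0 1) t :=
      (hC.differentiableOn one_ne_zero t ht).hasDerivWithinAt
    have h2 : HasDerivWithinAt (fun s => S (φ (γ s))) (S (derivWithin (φ ∘ γ) (Set.Icc 0 1) t))
        (Set.Icc 0 1) t := S.hasFDerivAt.comp_hasDerivWithinAt t h1
    rw [h2.derivWithin huniq]
    have h3 : mfderivWithin 𝓘(ℝ, ℝ) 𝓘(ℝ, E) (φ ∘ γ) (Set.Icc 0 1) t =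
        (mfderiv 𝓘(ℝ, E) 𝓘(ℝ, E) φ (γ t)).comp
          (mfderivWithin 𝓘(ℝ, ℝ) 𝓘(ℝ, E) γ (Set.Icc 0 1) t) := by
      apply mfderiv_comp_mfderivWithin
      · exact mdifferentiableAt_extChartAt (hs t ht)
      · exact (hγ.mdifferentiable one_ne_zero).mdifferentiableOn _ ht
      · rw [uniqueMDiffWithinAt_iff_uniqueDiffWithinAt]
        exact huniq
    rw [mfderivWithin_eq_fderivWithin] at h3
    rw [← fderivWithin_derivWithin]
    exact congrArg S (congrArg (fun L : ℝ →L[ℝ] E => L 1) h3)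
  have hSC : ContDiffOn ℝ 1 (fun s => S (φ (γ s))) (Set.Icc 0 1) := S.contDiff.comp_contDiffOn hC
  refine (enorm_sub_le_lintegral_derivWithin_Icc_of_contDiffOn_Icc hSC zero_le_one).trans ?_
  rw [Manifold.pathELength_eq_lintegral_mfderivWithin_Icc, ← MeasureTheory.lintegral_const_mul' _ _ hc]
  refine MeasureTheory.setLIntegral_mono' measurableSet_Icc fun t ht => ?_
  rw [hderiv t ht]
  exact hS t ht _

/-- The Riemannian distance of the end points of a segment in a chart. -/
theorem riemannianEDist_le_enorm_sub_chart {F : Type*} [NormedAddCommGroup F] [NormedSpace ℝ F]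
    (x : M) (S : E →L[ℝ] F) (c : ℝ≥0∞) {s : Set E} (hs : Convex ℝ s)
    (hst : s ⊆ (extChartAt 𝓘(ℝ, E) x).target)
    (hS : ∀ z ∈ s, ∀ w : E, ‖mfderivWithin 𝓘(ℝ, E) 𝓘(ℝ, E) (extChartAt 𝓘(ℝ, E) x).symm
      (Set.range 𝓘(ℝ, E)) z w‖ₑ ≤ c * ‖S w‖ₑ)
    {p q : M} (hp : p ∈ (chartAt E x).source) (hq : q ∈ (chartAt E x).source)
    (hps : extChartAt 𝓘(ℝ, E) x p ∈ s) (hqs : extChartAt 𝓘(ℝ, E) x q ∈ s) :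
    Manifold.riemannianEDist 𝓘(ℝ, E) p q ≤
      c * ‖S (extChartAt 𝓘(ℝ, E) x q) - S (extChartAt 𝓘(ℝ, E) x p)‖ₑ := by
  set η := ContinuousAffineMap.lineMap (R := ℝ) (extChartAt 𝓘(ℝ, E) x p)
    (extChartAt 𝓘(ℝ, E) x q) with hηdef
  set γ := (extChartAt 𝓘(ℝ, E) x).symm ∘ η
  have hη : ∀ t ∈ Set.Icc (0 : ℝ) 1, η t ∈ s := by
    intro t ht
    rw [hηdef, ContinuousAffineMap.coe_lineMap_eq]
    exact hs.lineMap_mem hps hqs ht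
  have η_smooth : ContMDiffOn 𝓘(ℝ, ℝ) 𝓘(ℝ, E) 1 η (Set.Icc 0 1) := by
    apply ContMDiff.contMDiffOn
    rw [contMDiff_iff_contDiff]
    exact ContinuousAffineMap.contDiff _
  have h1 : Manifold.riemannianEDist 𝓘(ℝ, E) p q ≤ Manifold.pathELength 𝓘(ℝ, E) γ 0 1 := by
    apply Manifold.riemannianEDist_le_pathELength _ _ _ zero_le_one
    · exact (contMDiffOn_extChartAt_symm x).comp η_smooth fun t ht => hst (hη t ht)
    · simp [γ, η, ContinuousAffineMap.coe_lineMap_eq, hp]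
    · simp [γ, η, ContinuousAffineMap.coe_lineMap_eq, hq]
  refine h1.trans ?_
  rw [Manifold.pathELength_eq_lintegral_mfderivWithin_Icc]
  have h2 : ∀ t ∈ Set.Icc (0 : ℝ) 1,
      ‖mfderivWithin 𝓘(ℝ, ℝ) 𝓘(ℝ, E) γ (Set.Icc 0 1) t (1 : ℝ)‖ₑ ≤
        c * ‖S (extChartAt 𝓘(ℝ, E) x q) - S (extChartAt 𝓘(ℝ, E) x p)‖ₑ := by
    intro t ht
    have huniq := uniqueDiffOn_Icc (zero_lt_one' ℝ) t ht
    have h3 : mfderivWithin 𝓘(ℝ, ℝ) 𝓘(ℝ, E) γ (Set.Icc 0 1) t =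
        (mfderivWithin 𝓘(ℝ, E) 𝓘(ℝ, E) (extChartAt 𝓘(ℝ, E) x).symm (Set.range 𝓘(ℝ, E))
          (η t)).comp (mfderivWithin 𝓘(ℝ, ℝ) 𝓘(ℝ, E) η (Set.Icc 0 1) t) := by
      apply mfderivWithin_comp
      · exact mdifferentiableWithinAt_extChartAt_symm (hst (hη t ht))
      · exact η_smooth.mdifferentiableOn one_ne_zero t ht
      · exact fun t ht => extChartAt_target_subset_range x (hst (hη t ht))
      · rw [uniqueMDiffWithinAt_iff_uniqueDiffWithinAt]
        exact huniq
    have h4 : mfderivWithin 𝓘(ℝ, ℝ) 𝓘(ℝ, E) η (Set.Icc 0 1) t (1 : ℝ) =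
        extChartAt 𝓘(ℝ, E) x q - extChartAt 𝓘(ℝ, E) x p := by
      rw [mfderivWithin_eq_fderivWithin, fderivWithin_eq_fderiv huniq
        (ContinuousAffineMap.differentiableAt _), hηdef, ContinuousAffineMap.coe_lineMap_eq]
      exact (fderiv_apply_one_eq_deriv (𝕜 := ℝ)).trans AffineMap.hasDerivAt_lineMap.deriv
    rw [h3, ← map_sub, ← h4]
    exact hS (η t) (hη t ht) _
  calc _ ≤ ∫⁻ _ in Set.Icc (0 : ℝ) 1,
        c * ‖S (extChartAt 𝓘(ℝ, E) x q) - S (extChartAt 𝓘(ℝ, E) x p)‖ₑ :=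
        MeasureTheory.setLIntegral_mono' measurableSet_Icc h2
    _ = _ := by simp

variable [IsContMDiffRiemannianBundle 𝓘(ℝ, E) ∞ E (fun x : M => TangentSpace 𝓘(ℝ, E) x)]

/-- Continuity of the metric is all that the norm comparisons below need. -/
theorem isContinuousRiemannianBundle_tangentSpace :
    IsContinuousRiemannianBundle E (fun x : M => TangentSpace 𝓘(ℝ, E) x) := by
  obtain ⟨g, hg, h⟩ := IsContMDiffRiemannianBundle.exists_contMDiff (IB := 𝓘(ℝ, E)) (n := ∞)
    (F := E) (E := fun x : M => TangentSpace 𝓘(ℝ, E) x)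
  exact ⟨g, hg.continuous, h⟩

/-- The inverse of the derivative of the chart at `x`. -/
abbrev tangentChartSymm (x : M) : E →L[ℝ] TangentSpace 𝓘(ℝ, E) x :=
  (trivializationAt E (TangentSpace 𝓘(ℝ, E)) x).symmL ℝ x

/-- The inverse trivialization at `y` composed with the trivialization at `x` is the identity for `y
= x`, so by continuity of the metric its norm stays below `r` nearby. The next lemma is the same
with the roles of `x` and `y` exchanged. On the chart domain these maps are the derivatives of the
chart and of its inverse. -/
theorem eventually_norm_mfderiv_symm_le (x : M) {r : ℝ} (hr : 1 < r) :
    ∀ᶠ y in 𝓝 x, ∀ w : E, ‖(trivializationAt E (TangentSpace 𝓘(ℝ, E)) x).symmL ℝ y w‖ ≤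
      r * ‖tangentChartSymm x w‖ := by
  have := isContinuousRiemannianBundle_tangentSpace (E := E) (M := M)
  filter_upwards [eventually_norm_symmL_trivializationAt_comp_self_lt E
    (fun x : M => TangentSpace 𝓘(ℝ, E) x) x hr] with y hy w
  have hx : x ∈ (trivializationAt E (TangentSpace 𝓘(ℝ, E)) x).baseSet :=
    FiberBundle.mem_baseSet_trivializationAt' x
  have h := ContinuousLinearMap.le_of_opNorm_le _ hy.le (tangentChartSymm x w)
  have e : (trivializationAt E (TangentSpace 𝓘(ℝ, E)) x).continuousLinearMapAt ℝ x
      (tangentChartSymm x w) = w := Bundle.Trivialization.continuousLinearMapAt_symmL _ hx w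
  rwa [ContinuousLinearMap.comp_apply, e] at h

theorem eventually_norm_mfderiv_le (x : M) {r : ℝ} (hr : 1 < r) :
    ∀ᶠ y in 𝓝 x, ∀ v : TangentSpace 𝓘(ℝ, E) y,
      ‖tangentChartSymm x
        ((trivializationAt E (TangentSpace 𝓘(ℝ, E)) x).continuousLinearMapAt ℝ y v)‖ ≤
      r * ‖v‖ := by
  have := isContinuousRiemannianBundle_tangentSpace (E := E) (M := M)
  filter_upwards [eventually_norm_symmL_trivializationAt_self_comp_lt E
    (fun x : M => TangentSpace 𝓘(ℝ, E) x) x hr] with y hy v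
  exact ContinuousLinearMap.le_of_opNorm_le _ hy.le v

/-- The chart at `x`, read in the tangent space at `x`. -/
def linearChart (x : M) (p : M) : TangentSpace 𝓘(ℝ, E) x :=
  tangentChartSymm x (extChartAt 𝓘(ℝ, E) x p)

variable [IsRiemannianManifold 𝓘(ℝ, E) M]

/-- The points are joined by the straight segment in the chart. It stays in a ball, which is convex,
where the inverse chart expands by at most `r`. -/
theorem eventually_dist_le_mul_dist_linearChart (x : M) {r : ℝ} (hr : 1 < r) :
    ∀ᶠ q : M × M in 𝓝 (x, x),
      dist q.1 q.2 ≤ r * dist (linearChart (E := E) x q.1) (linearChart x q.2) := by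
  have h1 := eventually_norm_mfderiv_symm_le (E := E) x hr
  have hc : Filter.Tendsto (extChartAt 𝓘(ℝ, E) x).symm (𝓝 (extChartAt 𝓘(ℝ, E) x x)) (𝓝 x) := by
    have h := (continuousAt_extChartAt_symm (I := 𝓘(ℝ, E)) x).tendsto
    rwa [extChartAt_to_inv] at h
  have h2 := hc.eventually h1
  obtain ⟨ρ, hρ, hball⟩ := Metric.mem_nhds_iff.mp
    (Filter.inter_mem (extChartAt_target_mem_nhds (I := 𝓘(ℝ, E)) x) h2)
  have h3 : ∀ᶠ p in 𝓝 x, p ∈ (chartAt E x).source ∧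
      extChartAt 𝓘(ℝ, E) x p ∈ Metric.ball (extChartAt 𝓘(ℝ, E) x x) ρ :=
    Filter.Eventually.and (chart_source_mem_nhds E x)
      ((continuousAt_extChartAt x).eventually (Metric.ball_mem_nhds _ hρ))
  rw [nhds_prod_eq]
  filter_upwards [h3.prod_mk h3] with q hq
  have h4 := riemannianEDist_le_enorm_sub_chart (F := TangentSpace 𝓘(ℝ, E) x) x
    (tangentChartSymm x) (ENNReal.ofReal r)
    (convex_ball (extChartAt 𝓘(ℝ, E) x x) ρ) (fun z hz => (hball hz).1) (fun z hz w => by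
      have hz1 := (hball hz).1
      have hz2 := (hball hz).2 w
      have hsrc : (extChartAt 𝓘(ℝ, E) x).symm z ∈ (chartAt E x).source := by
        rw [← extChartAt_source 𝓘(ℝ, E)]
        exact (extChartAt 𝓘(ℝ, E) x).map_target hz1
      rw [TangentBundle.symmL_trivializationAt hsrc, (extChartAt 𝓘(ℝ, E) x).right_inv hz1] at hz2
      rw [← ofReal_norm, ← ofReal_norm, ← ENNReal.ofReal_mul (by linarith)]
      exact ENNReal.ofReal_le_ofReal hz2) hq.1.1 hq.2.1 hq.1.2 hq.2.2
  rw [← IsRiemannianManifold.out (I := 𝓘(ℝ, E)), edist_dist, ← ofReal_norm,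
    ← ENNReal.ofReal_mul (by linarith), ENNReal.ofReal_le_ofReal_iff (by positivity)] at h4
  rw [dist_comm (linearChart x q.1), dist_eq_norm]
  exact h4

/-- A nearly shortest path is mapped to the linearised chart, which expands its length by at most
`r`. -/
theorem eventually_dist_linearChart_le_mul_dist (x : M) {r : ℝ} (hr : 1 < r) :
    ∀ᶠ q : M × M in 𝓝 (x, x),
      dist (linearChart (E := E) x q.1) (linearChart x q.2) ≤ r * dist q.1 q.2 := by
  obtain ⟨ρ, hρ, hball⟩ := Metric.mem_nhds_iff.mp (Filter.inter_mem (chart_source_mem_nhds E x)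
    (eventually_norm_mfderiv_le (E := E) x hr))
  -- Points within `ρ / 3` of `x` are joined by paths shorter than `2 * ρ / 3`, and these cannot
  -- leave the ball of radius `ρ`.
  have h3 : ∀ᶠ p in 𝓝 x, p ∈ Metric.ball x (ρ / 3) := Metric.ball_mem_nhds x (by positivity)
  rw [nhds_prod_eq]
  filter_upwards [h3.prod_mk h3] with q hq
  obtain ⟨p, q⟩ := q
  have hp : dist p x < ρ / 3 := hq.1
  have hpq : dist p q < 2 * ρ / 3 := by
    have : dist q x < ρ / 3 := hq.2
    linarith [dist_triangle_right p q x]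
  -- A shortest path need not exist, so an arbitrary `a > r * dist p q` leaves room for one of
  -- length less than `a / r`.
  refine le_of_forall_gt_imp_ge_of_dense fun a ha => ?_
  have hr0 : 0 < r := by linarith
  have ha' : dist p q < min (a / r) (2 * ρ / 3) := lt_min (by
    rw [lt_div_iff₀ hr0, mul_comm]; exact ha) hpq
  have hR : Manifold.riemannianEDist 𝓘(ℝ, E) p q < ENNReal.ofReal (min (a / r) (2 * ρ / 3)) := by
    rw [← IsRiemannianManifold.out (I := 𝓘(ℝ, E)), edist_dist]
    exact (ENNReal.ofReal_lt_ofReal_iff (dist_nonneg.trans_lt ha')).mpr ha'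
  obtain ⟨γ, hγ0, hγ1, hγ, hlen, -⟩ :=
    Manifold.exists_lt_locally_constant_of_riemannianEDist_lt hR zero_lt_one
  have hmem : ∀ t ∈ Set.Icc (0 : ℝ) 1, γ t ∈ Metric.ball x ρ := by
    intro t ht
    have h4 : edist p (γ t) < ENNReal.ofReal (min (a / r) (2 * ρ / 3)) := by
      rw [IsRiemannianManifold.out (I := 𝓘(ℝ, E))]
      exact ((Manifold.riemannianEDist_le_pathELength hγ.contMDiffOn hγ0 rfl ht.1).trans
        (Manifold.pathELength_mono le_rfl ht.2)).trans_lt hlen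
    rw [edist_dist, ENNReal.ofReal_lt_ofReal_iff (dist_nonneg.trans_lt ha')] at h4
    have h5 := h4.trans_le (min_le_right _ _)
    rw [Metric.mem_ball]
    rw [dist_comm] at h5
    linarith [dist_triangle (γ t) p x]
  have h6 := enorm_sub_chart_le_pathELength (F := TangentSpace 𝓘(ℝ, E) x) x
    (tangentChartSymm x) (ENNReal.ofReal r)
    ENNReal.ofReal_ne_top hγ (fun t ht => (hball (hmem t ht)).1) (fun t ht v => by
      have h7 := (hball (hmem t ht)).2 v
      rw [TangentBundle.continuousLinearMapAt_trivializationAt (hball (hmem t ht)).1] at h7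
      rw [← ofReal_norm, ← ofReal_norm, ← ENNReal.ofReal_mul hr0.le]
      exact ENNReal.ofReal_le_ofReal h7)
  rw [hγ0, hγ1, ← ofReal_norm] at h6
  have h8 := h6.trans (mul_le_mul_right hlen.le _)
  rw [← ENNReal.ofReal_mul hr0.le, ENNReal.ofReal_le_ofReal_iff
    (mul_nonneg hr0.le (dist_nonneg.trans ha'.le))] at h8
  rw [dist_comm, dist_eq_norm]
  refine (show ‖linearChart (E := E) x q - linearChart x p‖ ≤ _ from h8).trans ?_
  calc r * min (a / r) (2 * ρ / 3) ≤ r * (a / r) := by gcongr; exact min_le_left _ _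
    _ = a := mul_div_cancel₀ _ hr0.ne'

end Riemannian

/-! ### The upper bound for Riemannian manifolds -/

theorem poincareModulus_le_of_riemannian (E : Type*) [NormedAddCommGroup E]
    [InnerProductSpace ℝ E] {M : Type*} [MetricSpace M] [CompleteSpace M] [ChartedSpace E M]
    [IsManifold 𝓘(ℝ, E) ∞ M] [Bundle.RiemannianBundle (fun x : M => TangentSpace 𝓘(ℝ, E) x)]
    [IsContMDiffRiemannianBundle 𝓘(ℝ, E) ∞ E (fun x : M => TangentSpace 𝓘(ℝ, E) x)]
    [IsRiemannianManifold 𝓘(ℝ, E) M] (hM : IsCAT0 M) {σ : ℝ} (hσ : 0 < σ) :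
    poincareModulus 2 M σ ≤ ENNReal.ofReal (2 / √σ) := by
  have h : ∀ x : M, poincareModulus 2 (TangentCone x) σ ≤ ENNReal.ofReal (1 / √σ) := fun x =>
    hM.poincareModulus_tangentCone_le (linearChart (E := E) x) (fun r hr =>
      (eventually_dist_le_mul_dist_linearChart x hr).and
        (eventually_dist_linearChart_le_mul_dist x hr)) hσ
  calc poincareModulus 2 M σ ≤ 2 * ⨆ x : M, poincareModulus 2 (TangentCone x) σ :=
        hM.poincareModulus_le σ
    _ ≤ 2 * ENNReal.ofReal (1 / √σ) := mul_le_mul_right (iSup_le h) _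
    _ = ENNReal.ofReal (2 / √σ) := by
        rw [← ENNReal.ofReal_ofNat, ← ENNReal.ofReal_mul (by norm_num), mul_one_div]

end WangTrick

end

theorem mainTheorem11 :
    (∀ (Y : Type*) [MetricSpace Y] [CompleteSpace Y], WangTrick.IsCAT0 Y → ∀ σ : ℝ,
      (∀ N : ℕ, WangTrick.localPoincareModulus 2 Y σ N ≤
        2 * ⨆ y : Y, WangTrick.localPoincareModulus 2 (WangTrick.TangentCone y) σ N) ∧
      WangTrick.poincareModulus 2 Y σ ≤
        2 * ⨆ y : Y, WangTrick.poincareModulus 2 (WangTrick.TangentCone y) σ) ∧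
    (∀ (E : Type*) [NormedAddCommGroup E] [InnerProductSpace ℝ E] [CompleteSpace E]
      (M : Type*) [MetricSpace M] [CompleteSpace M] [ChartedSpace E M]
      [IsManifold 𝓘(ℝ, E) ∞ M]
      [Bundle.RiemannianBundle (fun x : M => TangentSpace 𝓘(ℝ, E) x)]
      [IsContMDiffRiemannianBundle 𝓘(ℝ, E) ∞ E (fun x : M => TangentSpace 𝓘(ℝ, E) x)]
      [IsRiemannianManifold 𝓘(ℝ, E) M], WangTrick.IsCAT0 M → ∀ σ : ℝ, 0 < σ →
        WangTrick.poincareModulus 2 M σ ≤ ENNReal.ofReal (2 / √σ) ∧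
        (Nontrivial M → σ ≤ 2 →
          ENNReal.ofReal (1 / √σ) ≤ WangTrick.poincareModulus 2 M σ)) := by
  refine ⟨fun Y _ _ hY σ => ⟨hY.localPoincareModulus_le σ, hY.poincareModulus_le σ⟩, ?_⟩
  intro E _ _ _ M _ _ _ _ _ _ _ hM σ hσ
  exact ⟨WangTrick.poincareModulus_le_of_riemannian E hM hσ,
    fun _ h2 => WangTrick.ofReal_inv_sqrt_le_poincareModulus hσ h2⟩
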